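/- For a domain $D\subset\mathbb C^n$ let $A^2(D)$ be the Bergman space of square-integrable holomorphic functions on $D$, and let $K_D(z,w)$ be its reproducing (Bergman) kernel: $K_D(\cdot,w)\in A^2(D)$ and $f(w)=\int_D f\,\overline{K_D(\cdot,w)}$ for all $f\in A^2(D)$, $w\in D$. Write $K_D(z)=K_D(z,z)$, and let $|\cdot|$ denote Lebesgue measure for sets. Let $n\ge 2$, let $\Omega\subset\mathbb C^n$ be a domain and let $E_0\subset\mathbb C^n$ be a closed set such that 1. there is $r>0$ with $\{z\in\mathbb C^n: d(z,E_0)\le r\}\subset\Omega$; 2. there are a (nonempty) real affine subspace $H\subset\mathbb R^{2n}=\mathbb C^n$ of real codimension $\ge 3$ and $R>0$ with $E_0\subset\{z\in\mathbb C^n: d(z,H)<R\}$; 3. $\Omega\setminus E_0$ is connected. (When $E_0=\emptyset$, the set in (1) is empty.) Then there is a constant $C<\infty$, depending only on $\Omega$ and $E_0$, such that for every closed set $E\subset E_0$ for which $\Omega\setminus E$ is connected and all $z,w\in\Omega\setminus E$, $$|K_{\Omega\setminus E}(z,w)-K_\Omega(z,w)|\le C\,|E|\,\bigl(K_\Omega(z)+K_\Omega(w)\bigr),$$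 where, if $|E|=\infty$, the right-hand side is read in $[0,\infty]$ with $0\cdot\infty=0$. In particular, if in addition $|E|=0$, then $K_{\Omega\setminus E}(z,w)=K_\Omega(z,w)$ for all $z,w\in\Omega\setminus E$. -/

import Mathlib

open MeasureTheory
open scoped ENNReal NNReal ComplexConjugate

noncomputable section

/-- Complex Euclidean space `ℂⁿ`, with its Euclidean norm and Lebesgue measure. -/
abbrev Cn (n : ℕ) : Type := EuclideanSpace ℂ (Fin n)

/-- The Bergman space `A²(Ω)`: the functions that are holomorphic and square integrable on `Ω`
(only the values on `Ω` matter). -/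
def bergmanSpace {n : ℕ} (Ω : Set (Cn n)) : Set (Cn n → ℂ) :=
  {f | DifferentiableOn ℂ f Ω ∧ MemLp f 2 (volume.restrict Ω)}

/-- `k` represents the evaluation at `w` on `A²(Ω)`, i.e. `k = K_Ω(·, w)` on `Ω`. -/
def IsReproducingAt {n : ℕ} (Ω : Set (Cn n)) (w : Cn n) (k : Cn n → ℂ) : Prop :=
  k ∈ bergmanSpace Ω ∧
    ∀ f ∈ bergmanSpace Ω, f w = ∫ ζ in Ω, f ζ * conj (k ζ)

open Classical in
/-- The Bergman kernel `K_Ω(z, w)`, the reproducing kernel of `A²(Ω)`. For `Ω` open and `w ∈ Ω`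
a representing function exists by the Riesz theorem, and its values on `Ω` are unique;
the value `0` is used only where there is none. -/
def bergmanKernel {n : ℕ} (Ω : Set (Cn n)) (z w : Cn n) : ℂ :=
  if h : ∃ k, IsReproducingAt Ω w k then h.choose z else 0

/-- The Bergman kernel on the diagonal, `K_Ω(z) = K_Ω(z, z)`, a nonnegative real number. -/
def bergmanDiag {n : ℕ} (Ω : Set (Cn n)) (z : Cn n) : ℝ :=
  (bergmanKernel Ω z z).re

end

/-! The heart is a Hartogs extension with an L² bound: each f in A²(Ω \ E₀) is the restriction of a
holomorphic F on Ω with ‖F‖² ≤ C‖f‖² (`exists_bergman_extension`). Since E₀ may be unbounded, Cauchy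
transforms are taken along complex lines z + ℂa with a orthogonal to the direction of H. Such a line
meets a tube around H only in a strip |Re ζ| ≤ const, where exp(ζ²) decays like a Gaussian; so
exp(ζ²)/ζ, with the same residue at 0 as 1/ζ, is a Cauchy kernel that is integrable at infinity.

Let X and Y be cutoffs equal to one near E₀ whose gradients live in an outer and an inner shell, and
let T_X, T_Y be the transforms of f times ∂̄ of the cutoff (`sliceTransform`). By Stokes' theorem
T_X is holomorphic inside the outer shell and T_Y outside the inner one; by Cauchy–Pompeiu T_X − T_Y
= −2πf in between. Hence −T_X/2π inside and f − T_Y/2π outside glue to F. Codimension three leaves a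
second real form m, bounded on the tube and zero on ℂa: where |m| is large the lines miss the tube
and T_Y = 0. The identity theorem carries this zero to the collar of E₀, so F = f near a point
there, and then on the connected set Ω \ E₀. It remains to bound F on E₀, where the kernel is only
used away from ζ = 0 and Schur's test applies.

For the kernels put D = Ω \ E and extend K_D(·,w) to G in A²(Ω); restricting first to Ω \ E₀ makes C
independent of E. Reproducing in Ω and in D gives K_D(z,w) − K_Ω(z,w) = ∫_E G conj K_Ω(·,z). Balls
of radius r about E lie in Ω, so point evaluations on E have a uniform bound A, and the integral is
at most A²|E|‖G‖‖K_Ω(·,z)‖. Finally ‖G‖² ≤ C K_D(w), and K_D(w) ≤ C K_Ω(w) follows by evaluating G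
at w (`enorm_bergmanKernel_sub_le`). -/

/-! ### Mean values, Cauchy estimates and the identity theorem in ℂⁿ. -/

section SeveralVariables

open Metric Set Filter Topology

/-- Multiplication by a complex number of modulus one, as a real linear isometry of `ℂⁿ`. -/
noncomputable def unitSMulIsometry {n : ℕ} (c : ℂ) (hc : ‖c‖ = 1) : Cn n ≃ₗᵢ[ℝ] Cn n :=
  have hc0 : c ≠ 0 := by
    rintro rfl
    simp at hc
  { toFun := fun x => c • x
    invFun := fun x => c⁻¹ • x
    map_add' := fun x y => smul_add c x y
    map_smul' := fun t x => smul_comm c t x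
    left_inv := fun x => inv_smul_smul₀ hc0 x
    right_inv := fun x => smul_inv_smul₀ hc0 x
    norm_map' := fun x => by
      change ‖c • x‖ = ‖x‖
      rw [norm_smul, hc, one_mul] }

/-- The mean value inequality on a circle, for the square of the modulus. -/
theorem enorm_sq_le_lintegral_circle {n : ℕ} {f : Cn n → ℂ} {y u : Cn n} {ρ : ℝ}
    (hf : DifferentiableOn ℂ f (ball y ρ)) (hu : u ∈ ball (0 : Cn n) ρ) :
    ‖f y‖ₑ ^ 2 ≤ ENNReal.ofReal ((2 * Real.pi)⁻¹) *
      ∫⁻ θ in Ioc 0 (2 * Real.pi), ‖f (y + circleMap 0 1 θ • u)‖ₑ ^ 2 := by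
  have hu' : ‖u‖ < ρ := by simpa using hu
  have hmaps : ∀ ζ : ℂ, ‖ζ‖ ≤ 1 → y + ζ • u ∈ ball y ρ := by
    intro ζ hζ
    rw [mem_ball_iff_norm, add_sub_cancel_left, norm_smul]
    calc ‖ζ‖ * ‖u‖ ≤ 1 * ‖u‖ := by gcongr
      _ < ρ := by simpa using hu'
  -- The square is itself holomorphic, so its mean value property gives the inequality for |f|²
  -- directly.
  set g : ℂ → ℂ := fun ζ => f (y + ζ • u) ^ 2 with hg
  have hgd : ∀ ζ : ℂ, ‖ζ‖ ≤ 1 → DifferentiableAt ℂ g ζ := by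
    intro ζ hζ
    have h1 : DifferentiableAt ℂ f (y + ζ • u) :=
      hf.differentiableAt (isOpen_ball.mem_nhds (hmaps ζ hζ))
    have h2 : DifferentiableAt ℂ (fun ζ : ℂ => y + ζ • u) ζ := by fun_prop
    exact (h1.comp ζ h2).pow 2
  have hav := circleAverage_of_differentiable_on_off_countable (f := g) (c := 0) (R := 1)
    (s := ∅) countable_empty
    (fun ζ hζ => (hgd ζ (by simpa using hζ)).continuousAt.continuousWithinAt)
    (fun ζ hζ => hgd ζ (by
      have := hζ.1
      simp only [abs_one, mem_ball, dist_zero_right] at this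
      exact this.le))
  have hg0 : g 0 = f y ^ 2 := by simp [hg]
  rw [hg0, Real.circleAverage_def, intervalIntegral.integral_of_le (by positivity)] at hav
  calc ‖f y‖ₑ ^ 2 = ‖f y ^ 2‖ₑ := by rw [enorm_pow]
    _ ≤ ‖(2 * Real.pi)⁻¹‖ₑ * ∫⁻ θ in Ioc 0 (2 * Real.pi), ‖g (circleMap 0 1 θ)‖ₑ := by
        rw [← hav, enorm_smul]
        gcongr
        exact enorm_integral_le_lintegral_enorm _
    _ = _ := by
        rw [Real.enorm_eq_ofReal (by positivity)]
        simp [hg, enorm_pow]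

theorem measurable_indicator_of_continuousOn {X Y : Type*} [TopologicalSpace X]
    [MeasurableSpace X] [OpensMeasurableSpace X] [TopologicalSpace Y] [MeasurableSpace Y]
    [BorelSpace Y] [Zero Y] {f : X → Y} {s : Set X} (hs : MeasurableSet s)
    (hf : ContinuousOn f s) : Measurable (s.indicator f) := by
  classical
  have heq : s.indicator f = s.piecewise f fun _ => 0 := by
    ext u
    simp [indicator, piecewise]
  rw [heq]
  exact hf.measurable_piecewise continuousOn_const hs

/-- The sub-mean value property of `|f|²` on balls of `ℂⁿ`. -/
theorem enorm_sq_mul_volume_le {n : ℕ} {f : Cn n → ℂ} {y : Cn n} {ρ : ℝ}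
    (hf : DifferentiableOn ℂ f (ball y ρ)) :
    ‖f y‖ₑ ^ 2 * volume (ball (0 : Cn n) ρ) ≤ ∫⁻ x in ball y ρ, ‖f x‖ₑ ^ 2 := by
  set h : Cn n → ℝ≥0∞ := (ball (0 : Cn n) ρ).indicator (fun u => ‖f (y + u)‖ₑ ^ 2) with hh
  have hcont : ContinuousOn (fun u => ‖f (y + u)‖ₑ ^ 2) (ball (0 : Cn n) ρ) := by
    have h1 : ContinuousOn (fun u => f (y + u)) (ball (0 : Cn n) ρ) := by
      refine hf.continuousOn.comp (by fun_prop) ?_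
      intro u hu
      simpa [mem_ball_iff_norm] using hu
    exact (ENNReal.continuous_pow 2).comp_continuousOn (continuous_enorm.comp_continuousOn h1)
  have hmeas : Measurable h := measurable_indicator_of_continuousOn measurableSet_ball hcont
  -- Rotations preserve Lebesgue measure, so averaging over θ turns circle means into the mean over
  -- the ball without polar coordinates.
  have hrot : ∀ θ : ℝ, ∫⁻ u, h (circleMap 0 1 θ • u) = ∫⁻ u, h u := by
    intro θ
    have hc : ‖circleMap 0 1 θ‖ = 1 := by simp
    exact ((unitSMulIsometry (n := n) _ hc).measurePreserving).lintegral_comp hmeas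
  have htrans : ∫⁻ x in ball y ρ, ‖f x‖ₑ ^ 2 = ∫⁻ u, h u := by
    rw [← lintegral_indicator measurableSet_ball, ← lintegral_add_left_eq_self _ y]
    congr 1
    ext u
    simp only [hh, indicator, mem_ball_iff_norm, add_sub_cancel_left, sub_zero]
  have hpt : ∀ u ∈ ball (0 : Cn n) ρ, ‖f y‖ₑ ^ 2 ≤ ENNReal.ofReal ((2 * Real.pi)⁻¹) *
      ∫⁻ θ in Ioc 0 (2 * Real.pi), h (circleMap 0 1 θ • u) := by
    intro u hu
    refine (enorm_sq_le_lintegral_circle hf hu).trans_eq ?_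
    congr 1
    refine lintegral_congr fun θ => ?_
    rw [hh, indicator_of_mem]
    simpa [norm_smul] using hu
  calc ‖f y‖ₑ ^ 2 * volume (ball (0 : Cn n) ρ)
      = ∫⁻ _ in ball (0 : Cn n) ρ, ‖f y‖ₑ ^ 2 := by rw [setLIntegral_const]
    _ ≤ ∫⁻ u in ball (0 : Cn n) ρ, ENNReal.ofReal ((2 * Real.pi)⁻¹) *
          ∫⁻ θ in Ioc 0 (2 * Real.pi), h (circleMap 0 1 θ • u) :=
        setLIntegral_mono' measurableSet_ball hpt
    _ ≤ ∫⁻ u, ENNReal.ofReal ((2 * Real.pi)⁻¹) *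
          ∫⁻ θ in Ioc 0 (2 * Real.pi), h (circleMap 0 1 θ • u) := setLIntegral_le_lintegral _ _
    _ = ENNReal.ofReal ((2 * Real.pi)⁻¹) * ∫⁻ θ in Ioc 0 (2 * Real.pi), ∫⁻ u,
          h (circleMap 0 1 θ • u) := by
        rw [lintegral_const_mul' _ _ ENNReal.ofReal_ne_top, lintegral_lintegral_swap]
        refine (hmeas.comp ?_).aemeasurable
        have : Continuous fun p : Cn n × ℝ => circleMap 0 1 p.2 • p.1 :=
          ((continuous_circleMap 0 1).comp continuous_snd).smul continuous_fst
        exact this.measurable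
    _ = ∫⁻ x in ball y ρ, ‖f x‖ₑ ^ 2 := by
        simp_rw [hrot]
        rw [setLIntegral_const, htrans, Real.volume_Ioc, sub_zero, mul_comm (∫⁻ u, h u),
          ← mul_assoc, ← ENNReal.ofReal_mul (by positivity), inv_mul_cancel₀ (by positivity),
          ENNReal.ofReal_one, one_mul]

/-- The Cauchy estimate for the derivative of a bounded holomorphic function on a ball. -/
theorem norm_fderiv_le_of_bounded_ball {n : ℕ} {f : Cn n → ℂ} {y : Cn n} {ρ B : ℝ} (hρ : 0 < ρ)
    (hf : DifferentiableOn ℂ f (ball y ρ)) (hB : ∀ x ∈ ball y ρ, ‖f x‖ ≤ B) :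
    ‖fderiv ℂ f y‖ ≤ 2 * B / ρ := by
  have hB0 : 0 ≤ B := (norm_nonneg _).trans (hB y (mem_ball_self hρ))
  refine ContinuousLinearMap.opNorm_le_bound _ (by positivity) fun u => ?_
  rcases eq_or_ne u 0 with rfl | hu
  · simp
  have hu0 : 0 < ‖u‖ := norm_pos_iff.2 hu
  -- The disc is mapped into the ball of radius ρ / 2, which keeps its closure inside the open ball
  -- and costs the factor 2.
  have hR : 0 < ρ / (2 * ‖u‖) := by positivity
  have hmaps : ∀ ζ : ℂ, ‖ζ‖ ≤ ρ / (2 * ‖u‖) → y + ζ • u ∈ ball y ρ := by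
    intro ζ hζ
    rw [mem_ball_iff_norm, add_sub_cancel_left, norm_smul]
    calc ‖ζ‖ * ‖u‖ ≤ ρ / (2 * ‖u‖) * ‖u‖ := by gcongr
      _ = ρ / 2 := by field_simp
      _ < ρ := by linarith
  have hd : ∀ ζ : ℂ, ‖ζ‖ ≤ ρ / (2 * ‖u‖) →
      HasDerivAt (fun ζ : ℂ => f (y + ζ • u)) (fderiv ℂ f (y + ζ • u) u) ζ := by
    intro ζ hζ
    have h1 := (hf.differentiableAt (isOpen_ball.mem_nhds (hmaps ζ hζ))).hasFDerivAt
    have h2 : HasDerivAt (fun ζ : ℂ => y + ζ • u) u ζ := by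
      simpa using ((hasDerivAt_id ζ).smul_const u).const_add y
    exact h1.comp_hasDerivAt ζ h2
  have h0 := hd 0 (by simpa using hR.le)
  have hcl : DiffContOnCl ℂ (fun ζ : ℂ => f (y + ζ • u)) (ball 0 (ρ / (2 * ‖u‖))) := by
    refine DifferentiableOn.diffContOnCl fun ζ hζ => ?_
    rw [closure_ball _ hR.ne'] at hζ
    exact (hd ζ (by simpa using hζ)).differentiableAt.differentiableWithinAt
  have := Complex.norm_deriv_le_of_forall_mem_sphere_norm_le hR hcl (C := B)
    fun ζ hζ => hB _ (hmaps ζ (by simpa using (mem_sphere_zero_iff_norm.1 hζ).le))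
  rw [h0.deriv] at this
  simp only [zero_smul, add_zero] at this
  refine this.trans_eq ?_
  field_simp

/-- Restriction to the complex line through p and x reduces this to one variable; the slice of the
ball is convex, hence connected. -/
theorem eq_zero_on_ball_of_eventuallyEq_zero {n : ℕ} {f : Cn n → ℂ} {c p : Cn n} {ρ : ℝ}
    (hf : DifferentiableOn ℂ f (ball c ρ)) (hp : p ∈ ball c ρ) (h0 : ∀ᶠ x in 𝓝 p, f x = 0) :
    ∀ x ∈ ball c ρ, f x = 0 := by
  intro x hx
  set φ : ℂ → Cn n := fun t => p + t • (x - p) with hφ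
  have hφc : Continuous φ := by fun_prop
  have hφd : Differentiable ℂ φ := by fun_prop
  set S : Set ℂ := φ ⁻¹' ball c ρ with hS
  have hSo : IsOpen S := isOpen_ball.preimage hφc
  have hSc : Convex ℝ S := by
    intro s hs t ht α β hα hβ hαβ
    have hs' : φ s ∈ ball c ρ := hs
    have ht' : φ t ∈ ball c ρ := ht
    have := convex_ball c ρ hs' ht' hα hβ hαβ
    change φ _ ∈ ball c ρ
    convert this using 1
    have hp' : p = α • p + β • p := by rw [← add_smul, hαβ, one_smul]
    simp only [hφ, smul_add, add_smul, smul_assoc]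
    nth_rewrite 1 [hp']
    abel
  have hg : DifferentiableOn ℂ (f ∘ φ) S := hf.comp hφd.differentiableOn fun t ht => ht
  have h00 : (0 : ℂ) ∈ S := by simpa [hS, hφ] using hp
  have hev : (f ∘ φ) =ᶠ[𝓝 0] 0 := by
    have : Tendsto φ (𝓝 0) (𝓝 p) := by
      have := hφc.tendsto 0
      simpa [hφ] using this
    exact this.eventually h0
  have := (hg.analyticOnNhd hSo).eqOn_zero_of_preconnected_of_eventuallyEq_zero
    hSc.isPreconnected h00 hev (x := 1) (by simpa [hS, hφ] using hx)
  simpa [hφ] using this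

/-- The identity theorem for holomorphic functions on a connected open subset of `ℂⁿ`. -/
theorem eq_zero_of_eventuallyEq_zero {n : ℕ} {f : Cn n → ℂ} {U : Set (Cn n)} (hU : IsOpen U)
    (hc : IsPreconnected U) (hf : DifferentiableOn ℂ f U) {p : Cn n} (hp : p ∈ U)
    (h0 : ∀ᶠ x in 𝓝 p, f x = 0) : ∀ x ∈ U, f x = 0 := by
  set Z : Set (Cn n) := {x | ∀ᶠ y in 𝓝 x, f y = 0} with hZ
  have hZo : IsOpen Z := isOpen_setOfPred_eventually_nhds
  have hsub : U ⊆ Z := by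
    refine hc.subset_of_closure_inter_subset hZo ⟨p, hp, h0⟩ ?_
    rintro x ⟨hx, hxU⟩
    obtain ⟨ρ, hρ, hball⟩ := Metric.isOpen_iff.1 hU x hxU
    obtain ⟨q, hqZ, hq⟩ := Metric.mem_closure_iff.1 hx ρ hρ
    have := eq_zero_on_ball_of_eventuallyEq_zero (hf.mono hball)
      (by rwa [mem_ball, dist_comm]) hqZ
    filter_upwards [isOpen_ball.mem_nhds (mem_ball_self hρ)] with y hy using this y hy
  exact fun x hx => (hsub hx).self_of_nhds

/-- Two holomorphic functions on a connected open set that agree near a point are equal. -/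
theorem eqOn_of_eventuallyEq_of_isPreconnected {n : ℕ} {f g : Cn n → ℂ} {U : Set (Cn n)}
    (hU : IsOpen U) (hc : IsPreconnected U) (hf : DifferentiableOn ℂ f U)
    (hg : DifferentiableOn ℂ g U) {p : Cn n} (hp : p ∈ U) (h0 : f =ᶠ[𝓝 p] g) : EqOn f g U :=
  fun x hx => sub_eq_zero.1 (eq_zero_of_eventuallyEq_zero hU hc (hf.sub hg) hp
    (h0.mono fun _ hy => sub_eq_zero.2 hy) x hx)

end SeveralVariables

/-! ### The Bergman space as a Hilbert space and its kernel. -/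

section BergmanSpace

open Metric Set Filter Topology

theorem eLpNorm_two_sq_eq_lintegral {α : Type*} [MeasurableSpace α] (μ : Measure α) (f : α → ℂ) :
    eLpNorm f 2 μ ^ 2 = ∫⁻ x, ‖f x‖ₑ ^ 2 ∂μ := by
  have := eLpNorm_nnreal_pow_eq_lintegral (f := f) (μ := μ) (p := 2) two_ne_zero
  simpa using this

/-- Point evaluations are bounded on `A²(Ω)`, uniformly at distance `ρ` from the boundary. -/
theorem exists_enorm_le_eLpNorm (n : ℕ) {ρ : ℝ} (hρ : 0 < ρ) :
    ∃ A : ℝ≥0, ∀ (Ω : Set (Cn n)) (y : Cn n) (f : Cn n → ℂ), ball y ρ ⊆ Ω →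
      DifferentiableOn ℂ f Ω → ‖f y‖ₑ ≤ A * eLpNorm f 2 (volume.restrict Ω) := by
  set V : ℝ≥0∞ := volume (ball (0 : Cn n) ρ) with hV
  have hV0 : V ≠ 0 := (measure_ball_pos volume _ hρ).ne'
  have hVt : V ≠ ∞ := measure_ball_lt_top.ne
  have hA : (V ^ (1 / 2 : ℝ))⁻¹ ≠ ∞ := by
    simp [hV0, hVt]
  refine ⟨((V ^ (1 / 2 : ℝ))⁻¹).toNNReal, fun Ω y f hy hf => ?_⟩
  rw [ENNReal.coe_toNNReal hA]
  have h1 : ‖f y‖ₑ ^ 2 * V ≤ eLpNorm f 2 (volume.restrict Ω) ^ 2 := by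
    rw [eLpNorm_two_sq_eq_lintegral]
    exact (enorm_sq_mul_volume_le (hf.mono hy)).trans (lintegral_mono_set hy)
  have h2 := ENNReal.rpow_le_rpow h1 (z := 1 / 2) (by norm_num)
  rw [ENNReal.mul_rpow_of_nonneg _ _ (by norm_num), ← ENNReal.rpow_natCast, ← ENNReal.rpow_natCast,
    ← ENNReal.rpow_mul, ← ENNReal.rpow_mul] at h2
  norm_num at h2
  rw [mul_comm, ← div_eq_mul_inv, ENNReal.le_div_iff_mul_le]
  · simpa using h2
  · left; simp [hV0, hVt]
  · left; simp [hV0, hVt]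

/-- The classes in `L²(Ω)` of the square integrable holomorphic functions on `Ω`. -/
def holomorphicL2 {n : ℕ} (Ω : Set (Cn n)) :
    Submodule ℂ (Lp ℂ 2 (volume.restrict Ω)) where
  carrier := {u | ∃ f, DifferentiableOn ℂ f Ω ∧ u =ᵐ[volume.restrict Ω] f}
  add_mem' := by
    rintro u v ⟨f, hf, huf⟩ ⟨g, hg, hvg⟩
    exact ⟨f + g, hf.add hg, (Lp.coeFn_add u v).trans (huf.add hvg)⟩
  zero_mem' := ⟨0, differentiableOn_const 0, Lp.coeFn_zero _ _ _⟩
  smul_mem' := by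
    rintro c u ⟨f, hf, huf⟩
    exact ⟨c • f, hf.const_smul c, (Lp.coeFn_smul c u).trans (huf.const_smul c)⟩

/-- This transfers L² convergence of classes to pointwise convergence of holomorphic
representatives; with u = v it shows that values do not depend on the representative. -/
theorem exists_norm_sub_le_norm_sub (n : ℕ) {ρ : ℝ} (hρ : 0 < ρ) :
    ∃ A : ℝ≥0, ∀ (Ω : Set (Cn n)) (y : Cn n) (f g : Cn n → ℂ)
      (u v : Lp ℂ 2 (volume.restrict Ω)), ball y ρ ⊆ Ω →
      DifferentiableOn ℂ f Ω → DifferentiableOn ℂ g Ω → u =ᵐ[volume.restrict Ω] f →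
      v =ᵐ[volume.restrict Ω] g → ‖f y - g y‖ ≤ A * ‖u - v‖ := by
  obtain ⟨A, hA⟩ := exists_enorm_le_eLpNorm n hρ
  refine ⟨A, fun Ω y f g u v hy hf hg huf hvg => ?_⟩
  have h1 := hA Ω y (f - g) hy (hf.sub hg)
  have h2 : eLpNorm (f - g) 2 (volume.restrict Ω) = ‖u - v‖ₑ := by
    rw [Lp.enorm_def]
    exact eLpNorm_congr_ae (((Lp.coeFn_sub u v).trans (huf.sub hvg)).symm)
  rw [h2, ← ofReal_norm, ← ofReal_norm, ← ENNReal.ofReal_coe_nnreal,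
    ← ENNReal.ofReal_mul A.coe_nonneg, ENNReal.ofReal_le_ofReal_iff (by positivity)] at h1
  exact h1

/-- L² convergence forces locally uniform convergence by the bound on evaluations; the Cauchy
estimates then make the derivatives converge locally uniformly, so the limit is holomorphic. -/
theorem isClosed_holomorphicL2 {n : ℕ} {Ω : Set (Cn n)} (hΩ : IsOpen Ω) :
    IsClosed (holomorphicL2 Ω : Set (Lp ℂ 2 (volume.restrict Ω))) := by
  rw [← isSeqClosed_iff_isClosed]
  intro u u₀ hu hlim
  choose f hf huf using hu
  have hcau : CauchySeq u := hlim.cauchySeq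
  -- uniform Cauchy property on small balls
  have hunif : ∀ (y : Cn n) (ρ : ℝ), 0 < ρ → ball y (2 * ρ) ⊆ Ω → ∀ ε > 0, ∃ N, ∀ k ≥ N, ∀ l ≥ N,
      ∀ x ∈ ball y ρ, ‖f k x - f l x‖ < ε := by
    intro y ρ hρ hy ε hε
    obtain ⟨A, hA⟩ := exists_norm_sub_le_norm_sub n hρ
    obtain ⟨N, hN⟩ := Metric.cauchySeq_iff.1 hcau (ε / (A + 1)) (by positivity)
    refine ⟨N, fun k hk l hl x hx => ?_⟩
    have hx' : ball x ρ ⊆ Ω := by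
      refine (ball_subset_ball' ?_).trans hy
      have := mem_ball.1 hx
      linarith
    refine (hA Ω x (f k) (f l) (u k) (u l) hx' (hf k) (hf l) (huf k) (huf l)).trans_lt ?_
    have h1 := hN k hk l hl
    rw [dist_eq_norm, lt_div_iff₀ (by positivity)] at h1
    nlinarith [norm_nonneg (u k - u l), A.coe_nonneg]
  have hloc : ∀ y ∈ Ω, ∃ ρ > 0, ball y (2 * ρ) ⊆ Ω := by
    intro y hy
    obtain ⟨ρ, hρ, h⟩ := Metric.isOpen_iff.1 hΩ y hy
    exact ⟨ρ / 2, by positivity, by convert h using 2; ring⟩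
  have hpt : ∀ y, ∃ c, y ∈ Ω → Tendsto (fun k => f k y) atTop (𝓝 c) := by
    intro y
    by_cases hy : y ∈ Ω
    · obtain ⟨ρ, hρ, hb⟩ := hloc y hy
      have : CauchySeq fun k => f k y := by
        rw [Metric.cauchySeq_iff]
        intro ε hε
        obtain ⟨N, hN⟩ := hunif y ρ hρ hb ε hε
        exact ⟨N, fun k hk l hl => by
          rw [dist_eq_norm]; exact hN k hk l hl y (mem_ball_self hρ)⟩
      obtain ⟨c, hc⟩ := cauchySeq_tendsto_of_complete this
      exact ⟨c, fun _ => hc⟩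
    · exact ⟨0, fun h => absurd h hy⟩
  choose g hg using hpt
  refine ⟨g, fun y hy => ?_, ?_⟩
  · obtain ⟨ρ, hρ, hb⟩ := hloc y hy
    have hsub : ball y ρ ⊆ Ω := (ball_subset_ball (by linarith)).trans hb
    set δ : ℝ := ρ / 2 with hδ
    have hδ0 : 0 < δ := by positivity
    have hball : ∀ x ∈ ball y δ, ball x δ ⊆ ball y ρ := fun x hx =>
      ball_subset_ball' (by have := mem_ball.1 hx; linarith)
    have hfd : ∀ k, ∀ x ∈ ball y ρ, DifferentiableAt ℂ (f k) x := fun k x hx =>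
      (hf k).differentiableAt (hΩ.mem_nhds (hsub hx))
    have hd : ∀ ε > 0, ∃ N, ∀ k ≥ N, ∀ l ≥ N, ∀ x ∈ ball y δ,
        dist (fderiv ℂ (f k) x) (fderiv ℂ (f l) x) < ε := by
      intro ε hε
      obtain ⟨N, hN⟩ := hunif y ρ hρ hb (ε * δ / 4) (by positivity)
      refine ⟨N, fun k hk l hl x hx => ?_⟩
      have hxρ : x ∈ ball y ρ := hball x hx (mem_ball_self hδ0)
      have hdiff : DifferentiableOn ℂ (f k - f l) (ball x δ) := fun x' hx' =>
        ((hfd k x' (hball x hx hx')).sub (hfd l x' (hball x hx hx'))).differentiableWithinAt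
      have h1 := norm_fderiv_le_of_bounded_ball hδ0 hdiff (B := ε * δ / 4)
        fun x' hx' => (hN k hk l hl x' (hball x hx hx')).le
      rw [fderiv_sub (hfd k x hxρ) (hfd l x hxρ)] at h1
      rw [dist_eq_norm]
      refine h1.trans_lt ?_
      rw [div_lt_iff₀ hδ0]
      nlinarith [mul_pos hε hδ0]
    have hcd : ∀ x, ∃ D, x ∈ ball y δ → Tendsto (fun k => fderiv ℂ (f k) x) atTop (𝓝 D) := by
      intro x
      by_cases hx : x ∈ ball y δ
      · have : CauchySeq fun k => fderiv ℂ (f k) x := by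
          rw [Metric.cauchySeq_iff]
          intro ε hε
          obtain ⟨N, hN⟩ := hd ε hε
          exact ⟨N, fun k hk l hl => hN k hk l hl x hx⟩
        obtain ⟨c, hc⟩ := cauchySeq_tendsto_of_complete this
        exact ⟨c, fun _ => hc⟩
      · exact ⟨0, fun h => absurd h hx⟩
    choose g' hg' using hcd
    have hU : TendstoUniformlyOn (fun k x => fderiv ℂ (f k) x) g' atTop (ball y δ) :=
      (Metric.uniformCauchySeqOn_iff.2 hd).tendstoUniformlyOn_of_tendsto fun x hx => hg' x hx
    have hyδ : y ∈ ball y δ := mem_ball_self hδ0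
    exact (hasFDerivAt_of_tendstoUniformlyOn isOpen_ball hU
      (fun k x hx => (hfd k x (hball x hx (mem_ball_self hδ0))).hasFDerivAt)
      (fun x hx => hg x (hsub (hball x hx (mem_ball_self hδ0)))) hyδ).differentiableAt.differentiableWithinAt
  -- An almost everywhere convergent subsequence identifies the L² limit with the pointwise limit g.
  · obtain ⟨ns, hns, hae⟩ := (tendstoInMeasure_of_tendsto_Lp hlim).exists_seq_tendsto_ae
    have hall : ∀ᵐ x ∂(volume.restrict Ω), ∀ k, u k x = f k x := ae_all_iff.2 huf
    filter_upwards [hae, hall, ae_restrict_mem hΩ.measurableSet] with x h1 h2 h3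
    simp only [h2] at h1
    exact tendsto_nhds_unique h1 ((hg x h3).comp hns.tendsto_atTop)

/-- The Bergman kernel exists, by the Riesz representation theorem. -/
theorem exists_isReproducingAt {n : ℕ} {Ω : Set (Cn n)} (hΩ : IsOpen Ω) {w : Cn n} (hw : w ∈ Ω) :
    ∃ k, IsReproducingAt Ω w k := by
  obtain ⟨ρ, hρ, hb⟩ := Metric.isOpen_iff.1 hΩ w hw
  obtain ⟨A, hA⟩ := exists_norm_sub_le_norm_sub n hρ
  let S := holomorphicL2 Ω
  have : CompleteSpace S := (isClosed_holomorphicL2 hΩ).completeSpace_coe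
  have hrep : ∀ u : S, ∃ f, DifferentiableOn ℂ f Ω ∧
      (u : Lp ℂ 2 (volume.restrict Ω)) =ᵐ[volume.restrict Ω] f := fun u => u.2
  choose φ hφd hφ using hrep
  -- The representatives φ u are arbitrary choices; uniqueness of the value at w is what makes
  -- evaluation linear.
  have huniq : ∀ (u : S) (f : Cn n → ℂ), DifferentiableOn ℂ f Ω →
      (u : Lp ℂ 2 (volume.restrict Ω)) =ᵐ[volume.restrict Ω] f → φ u w = f w := by
    intro u f hf huf
    have := hA Ω w (φ u) f u u hb (hφd u) hf (hφ u) huf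
    rw [sub_self, norm_zero, mul_zero] at this
    exact sub_eq_zero.1 (norm_le_zero_iff.1 this)
  let ev : S →ₗ[ℂ] ℂ :=
    { toFun := fun u => φ u w
      map_add' := fun u v => huniq (u + v) (φ u + φ v) ((hφd u).add (hφd v))
        ((Lp.coeFn_add _ _).trans ((hφ u).add (hφ v)))
      map_smul' := fun c u => huniq (c • u) (c • φ u) ((hφd u).const_smul c)
        ((Lp.coeFn_smul _ _).trans ((hφ u).const_smul c)) }
  have hev : ∀ u : S, ‖ev u‖ ≤ A * ‖u‖ := by
    intro u
    have h0 : ((0 : Lp ℂ 2 (volume.restrict Ω)) : Cn n → ℂ) =ᵐ[volume.restrict Ω]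
        (0 : Cn n → ℂ) := Lp.coeFn_zero _ _ _
    have := hA Ω w (φ u) 0 u 0 hb (hφd u) (differentiableOn_const 0) (hφ u) h0
    rw [sub_zero] at this
    change ‖φ u w‖ ≤ A * ‖(u : Lp ℂ 2 (volume.restrict Ω))‖
    simpa using this
  let K : S := (InnerProductSpace.toDual ℂ S).symm (ev.mkContinuous A hev)
  have hmem : ∀ u : S, MemLp (φ u) 2 (volume.restrict Ω) := fun u =>
    (memLp_congr_ae (hφ u)).1 (Lp.memLp _)
  refine ⟨φ K, ⟨hφd K, hmem K⟩, fun f hf => ?_⟩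
  let u : S := ⟨hf.2.toLp f, f, hf.1, hf.2.coeFn_toLp⟩
  have h1 : inner ℂ K u = ev u := InnerProductSpace.toDual_symm_apply
  have h2 : ev u = f w := huniq u f hf.1 hf.2.coeFn_toLp
  rw [← h2, ← h1, Submodule.coe_inner, L2.inner_def]
  refine integral_congr_ae ?_
  filter_upwards [hφ K, hf.2.coeFn_toLp] with x hx1 hx2
  rw [hx1, RCLike.inner_apply]
  congr 1

theorem isReproducingAt_bergmanKernel {n : ℕ} {Ω : Set (Cn n)} (hΩ : IsOpen Ω) {w : Cn n}
    (hw : w ∈ Ω) : IsReproducingAt Ω w fun z => bergmanKernel Ω z w := by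
  have h := exists_isReproducingAt hΩ hw
  have : (fun z => bergmanKernel Ω z w) = h.choose := by
    ext z
    simp [bergmanKernel, h]
  rw [this]
  exact h.choose_spec

theorem bergmanKernel_conj_symm {n : ℕ} {Ω : Set (Cn n)} (hΩ : IsOpen Ω) {z w : Cn n}
    (hz : z ∈ Ω) (hw : w ∈ Ω) : conj (bergmanKernel Ω z w) = bergmanKernel Ω w z := by
  have hkz := isReproducingAt_bergmanKernel hΩ hz
  have hkw := isReproducingAt_bergmanKernel hΩ hw
  rw [hkz.2 _ hkw.1, hkw.2 _ hkz.1, ← integral_conj]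
  simp [mul_comm]

theorem eLpNorm_bergmanKernel_sq {n : ℕ} {Ω : Set (Cn n)} (hΩ : IsOpen Ω) {w : Cn n}
    (hw : w ∈ Ω) : eLpNorm (fun z => bergmanKernel Ω z w) 2 (volume.restrict Ω) ^ 2 =
      ENNReal.ofReal (bergmanDiag Ω w) := by
  have hk := isReproducingAt_bergmanKernel hΩ hw
  rw [eLpNorm_two_sq_eq_lintegral, bergmanDiag, hk.2 _ hk.1]
  have h1 : ∀ ζ, bergmanKernel Ω ζ w * conj (bergmanKernel Ω ζ w) =
      ((‖bergmanKernel Ω ζ w‖ ^ 2 : ℝ) : ℂ) := fun ζ => by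
    rw [Complex.mul_conj, Complex.normSq_eq_norm_sq]
  simp_rw [h1]
  rw [integral_complex_ofReal, Complex.ofReal_re,
    ofReal_integral_eq_lintegral_ofReal (hk.1.2.integrable_norm_pow two_ne_zero)
      (Eventually.of_forall fun _ => by positivity)]
  refine lintegral_congr fun ζ => ?_
  rw [ENNReal.ofReal_pow (norm_nonneg _), ofReal_norm]

theorem bergmanDiag_nonneg {n : ℕ} {Ω : Set (Cn n)} (hΩ : IsOpen Ω) {w : Cn n}
    (hw : w ∈ Ω) : 0 ≤ bergmanDiag Ω w := by
  have hk := isReproducingAt_bergmanKernel hΩ hw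
  rw [bergmanDiag, hk.2 _ hk.1]
  have h1 : ∀ ζ, bergmanKernel Ω ζ w * conj (bergmanKernel Ω ζ w) =
      ((‖bergmanKernel Ω ζ w‖ ^ 2 : ℝ) : ℂ) := fun ζ => by
    rw [Complex.mul_conj, Complex.normSq_eq_norm_sq]
  simp_rw [h1]
  rw [integral_complex_ofReal, Complex.ofReal_re]
  exact integral_nonneg fun _ => by positivity

end BergmanSpace

/-! ### Stokes and Cauchy–Pompeiu formulas in the plane. -/

section PlaneCauchyRiemann

open Metric Set Filter Topology Complex

/-- Twice the Wirtinger derivative `∂/∂ζ̄` of a real function on the complex plane. -/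
noncomputable def dbar (η : ℂ → ℝ) (ζ : ℂ) : ℂ :=
  (fderiv ℝ η ζ 1 : ℂ) + I * (fderiv ℝ η ζ I : ℂ)

theorem continuous_dbar {η : ℂ → ℝ} (hη : ContDiff ℝ 1 η) : Continuous (dbar η) := by
  have h := hη.continuous_fderiv one_ne_zero
  unfold dbar
  fun_prop

theorem norm_dbar_le {η : ℂ → ℝ} {ζ : ℂ} {M : ℝ} (h : ‖fderiv ℝ η ζ‖ ≤ M) :
    ‖dbar η ζ‖ ≤ 2 * M := by
  have h1 : ‖fderiv ℝ η ζ 1‖ ≤ M := by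
    simpa using (fderiv ℝ η ζ).le_of_opNorm_le h 1
  have h2 : ‖fderiv ℝ η ζ I‖ ≤ M := by
    simpa using (fderiv ℝ η ζ).le_of_opNorm_le h I
  calc ‖dbar η ζ‖ ≤ ‖(fderiv ℝ η ζ 1 : ℂ)‖ + ‖I * (fderiv ℝ η ζ I : ℂ)‖ := norm_add_le _ _
    _ ≤ 2 * M := by
      rw [norm_mul, norm_I, one_mul, norm_real, norm_real]
      linarith

theorem dbar_eq_zero_of_notMem {η : ℂ → ℝ} {ζ : ℂ} (h : ζ ∉ tsupport η) : dbar η ζ = 0 := by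
  have h0 : fderiv ℝ η ζ = 0 := by
    by_contra hne
    exact h (support_fderiv_subset ℝ (f := η) hne)
  simp [dbar, h0]

theorem dbar_sub {η φ : ℂ → ℝ} {ζ : ℂ} (hη : DifferentiableAt ℝ η ζ)
    (hφ : DifferentiableAt ℝ φ ζ) : dbar (fun x => η x - φ x) ζ = dbar η ζ - dbar φ ζ := by
  simp only [dbar, fderiv_fun_sub hη hφ, sub_apply, ofReal_sub]
  ring

theorem integrable_mul_of_integrableOn {φ g : ℂ → ℂ} {T : Set ℂ} (hT : IsClosed T) {M : ℝ}
    (hφ : Continuous φ) (hM : ∀ ζ, ‖φ ζ‖ ≤ M) (h0 : ∀ ζ ∉ T, φ ζ = 0) (hg : IntegrableOn g T) :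
    Integrable fun ζ => φ ζ * g ζ := by
  have h1 : Integrable (T.indicator g) := (integrable_indicator_iff hT.measurableSet).2 hg
  refine (h1.bdd_mul hφ.aestronglyMeasurable (Eventually.of_forall hM)).congr
    (Eventually.of_forall fun ζ => ?_)
  by_cases h : ζ ∈ T
  · simp [indicator_of_mem h]
  · simp [h0 ζ h]

/-- Stokes' theorem in the plane: `∫ (∂η/∂ζ̄) g = 0` if `g` is holomorphic near the support
of `η`. -/
theorem integral_dbar_mul_eq_zero {η : ℂ → ℝ} {g : ℂ → ℂ} {M : ℝ} (hη : ContDiff ℝ 1 η)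
    (hM : ∀ ζ, ‖η ζ‖ ≤ M) (hM' : ∀ ζ, ‖fderiv ℝ η ζ‖ ≤ M)
    (hg : ∀ ζ ∈ tsupport η, DifferentiableAt ℂ g ζ) (hgi : IntegrableOn g (tsupport η))
    (hgi' : IntegrableOn (deriv g) (tsupport η)) : ∫ ζ, dbar η ζ * g ζ = 0 := by
  have hcl : IsClosed (tsupport η) := isClosed_tsupport η
  have hfd := hη.continuous_fderiv one_ne_zero
  have hfdz : ∀ ζ ∉ tsupport η, fderiv ℝ η ζ = 0 := by
    intro ζ h
    by_contra hne
    exact h (support_fderiv_subset ℝ (f := η) hne)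
  have hdir : ∀ v : ℂ, ‖v‖ = 1 → Integrable fun ζ => ((fderiv ℝ η ζ v : ℝ) : ℂ) * g ζ := by
    intro v hv
    refine integrable_mul_of_integrableOn hcl (M := M) (by fun_prop) (fun ζ => ?_)
      (fun ζ h => by simp [hfdz ζ h]) hgi
    rw [norm_real]
    simpa [hv] using (fderiv ℝ η ζ).le_of_opNorm_le (hM' ζ) v
  have hηc : Continuous fun ζ => ((η ζ : ℝ) : ℂ) := continuous_ofReal.comp hη.continuous
  have hηz : ∀ ζ ∉ tsupport η, ((η ζ : ℝ) : ℂ) = 0 := fun ζ h => by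
    simp [image_eq_zero_of_notMem_tsupport h]
  have hi0 : Integrable fun ζ => ((η ζ : ℝ) : ℂ) * g ζ :=
    integrable_mul_of_integrableOn hcl hηc (fun ζ => by simpa using hM ζ) hηz hgi
  have hi1 : Integrable fun ζ => ((η ζ : ℝ) : ℂ) * deriv g ζ :=
    integrable_mul_of_integrableOn hcl hηc (fun ζ => by simpa using hM ζ) hηz hgi'
  -- Integration by parts in the real direction v; since g is holomorphic, its derivative along v is
  -- v g'. The cases v = 1 and v = I cancel because 1 + I² = 0.
  have key : ∀ v : ℂ, ‖v‖ = 1 → v * ∫ ζ, ((η ζ : ℝ) : ℂ) * deriv g ζ =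
      -∫ ζ, ((fderiv ℝ η ζ v : ℝ) : ℂ) * g ζ := by
    intro v hv
    have := integral_bilinear_hasFDerivAt_right_eq_neg_left_of_integrable
      (μ := (volume : Measure ℂ)) (f := η) (f' := fderiv ℝ η) (g := g)
      (g' := fun ζ => (ContinuousLinearMap.toSpanSingleton ℂ (deriv g ζ)).restrictScalars ℝ)
      (v := v) (B := ContinuousLinearMap.lsmul ℝ ℝ)
      (by simpa using hdir v hv)
      (by
        have := hi1.const_mul v
        refine this.congr (Eventually.of_forall fun ζ => ?_)
        simp
        ring)
      (by simpa using hi0)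
      (fun ζ _ => (hη.differentiable one_ne_zero ζ).hasFDerivAt)
      (fun ζ hζ => ((hg ζ hζ).hasDerivAt.hasFDerivAt).restrictScalars ℝ)
    simp only [ContinuousLinearMap.lsmul_apply, real_smul] at this
    rw [← this, ← integral_const_mul]
    refine integral_congr_ae (Eventually.of_forall fun ζ => ?_)
    simp
    ring
  have h1 := key 1 (by simp)
  have h2 := key I (by simp)
  have h3 : ∫ ζ, dbar η ζ * g ζ = (∫ ζ, ((fderiv ℝ η ζ 1 : ℝ) : ℂ) * g ζ) +
      I * ∫ ζ, ((fderiv ℝ η ζ I : ℝ) : ℂ) * g ζ := by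
    rw [← integral_const_mul, ← integral_add (hdir 1 (by simp)) ((hdir I (by simp)).const_mul I)]
    refine integral_congr_ae (Eventually.of_forall fun ζ => ?_)
    simp only [dbar]
    ring
  rw [h3]
  linear_combination h1 + I * h2 - (∫ ζ, ((η ζ : ℝ) : ℂ) * deriv g ζ) * I_mul_I

/-- A radial cutoff function, equal to one for `|ζ| ≤ ρ / 2` and vanishing for
`2|ζ|² ≥ ρ²`. -/
noncomputable def radialCutoff (ρ : ℝ) (ζ : ℂ) : ℝ :=
  Real.smoothTransition (2 - 4 * ‖ζ‖ ^ 2 / ρ ^ 2)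

theorem contDiff_radialCutoff (ρ : ℝ) : ContDiff ℝ 1 (radialCutoff ρ) := by
  have h1 : ContDiff ℝ 1 fun ζ : ℂ => 2 - 4 * ‖ζ‖ ^ 2 / ρ ^ 2 := by
    have : ContDiff ℝ 1 fun ζ : ℂ => ‖ζ‖ ^ 2 := contDiff_norm_sq ℝ
    fun_prop
  exact (Real.smoothTransition.contDiff (n := 1)).comp h1

theorem radialCutoff_eq_one {ρ : ℝ} (hρ : 0 < ρ) {ζ : ℂ} (h : ‖ζ‖ ≤ ρ / 2) :
    radialCutoff ρ ζ = 1 := by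
  refine Real.smoothTransition.one_of_one_le ?_
  have h2 : 4 * ‖ζ‖ ^ 2 / ρ ^ 2 ≤ 1 := by
    rw [div_le_one (by positivity)]
    nlinarith [norm_nonneg ζ]
  linarith

theorem tsupport_radialCutoff_subset {ρ : ℝ} (hρ : 0 < ρ) :
    tsupport (radialCutoff ρ) ⊆ ball 0 ρ := by
  have hcl : IsClosed {ζ : ℂ | 2 * ‖ζ‖ ^ 2 ≤ ρ ^ 2} :=
    isClosed_le (by fun_prop) (by fun_prop)
  have hsub : tsupport (radialCutoff ρ) ⊆ {ζ : ℂ | 2 * ‖ζ‖ ^ 2 ≤ ρ ^ 2} := by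
    refine closure_minimal (fun ζ hζ => ?_) hcl
    by_contra hn
    simp only [mem_ofPred_eq, not_le] at hn
    refine hζ (Real.smoothTransition.zero_of_nonpos ?_)
    have : 2 ≤ 4 * ‖ζ‖ ^ 2 / ρ ^ 2 := by
      rw [le_div_iff₀ (by positivity)]
      linarith
    linarith
  intro ζ hζ
  have h := hsub hζ
  simp only [mem_ofPred_eq] at h
  rw [mem_ball_zero_iff]
  nlinarith [norm_nonneg ζ, sq_nonneg ρ]

theorem hasCompactSupport_radialCutoff {ρ : ℝ} (hρ : 0 < ρ) :
    HasCompactSupport (radialCutoff ρ) :=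
  (isCompact_closedBall (0 : ℂ) ρ).of_isClosed_subset (isClosed_tsupport _)
    ((tsupport_radialCutoff_subset hρ).trans ball_subset_closedBall)

/-- The gradient of a radial function is a real multiple of ζ, and this factor ζ cancels the pole of
1/ζ. -/
theorem dbar_radialCutoff (ρ : ℝ) (ζ : ℂ) : dbar (radialCutoff ρ) ζ =
    ((deriv Real.smoothTransition (2 - 4 * ‖ζ‖ ^ 2 / ρ ^ 2) * (-8 / ρ ^ 2) : ℝ) : ℂ) * ζ := by
  have h1 : HasFDerivAt (fun ζ : ℂ => ‖ζ‖ ^ 2) (2 • innerSL ℝ ζ) ζ :=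
    (hasStrictFDerivAt_norm_sq ζ).hasFDerivAt
  have h2 : HasFDerivAt (fun ζ : ℂ => 2 - 4 * ‖ζ‖ ^ 2 / ρ ^ 2)
      ((-4 / ρ ^ 2) • (2 • innerSL ℝ ζ)) ζ := by
    have := (h1.const_mul (-4 / ρ ^ 2)).const_add 2
    refine this.congr_of_eventuallyEq (Eventually.of_forall fun x => ?_)
    ring
  have h3 : HasDerivAt Real.smoothTransition
      (deriv Real.smoothTransition (2 - 4 * ‖ζ‖ ^ 2 / ρ ^ 2)) (2 - 4 * ‖ζ‖ ^ 2 / ρ ^ 2) :=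
    ((Real.smoothTransition.contDiff (n := 1)).differentiable one_ne_zero _).hasDerivAt
  have h4 : fderiv ℝ (radialCutoff ρ) ζ = _ := (h3.comp_hasFDerivAt ζ h2).fderiv
  have h5 : ∀ v, fderiv ℝ (radialCutoff ρ) ζ v =
      deriv Real.smoothTransition (2 - 4 * ‖ζ‖ ^ 2 / ρ ^ 2) * (-8 / ρ ^ 2) * inner ℝ ζ v := by
    intro v
    rw [h4]
    simp
    ring
  rw [dbar, h5, h5]
  generalize deriv Real.smoothTransition (2 - 4 * ‖ζ‖ ^ 2 / ρ ^ 2) * (-8 / ρ ^ 2) = c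
  apply Complex.ext <;> simp [Complex.inner]

/-- Normalization of the Cauchy kernel. -/
theorem integral_dbar_radialCutoff_div {ρ : ℝ} (hρ : 0 < ρ) :
    ∫ ζ, dbar (radialCutoff ρ) ζ * ζ⁻¹ = -(2 * Real.pi) := by
  set m : ℝ → ℝ := fun t =>
    deriv Real.smoothTransition (2 - 4 * t ^ 2 / ρ ^ 2) * (-8 / ρ ^ 2) with hm
  have h1 : ∫ ζ, dbar (radialCutoff ρ) ζ * ζ⁻¹ = ∫ ζ : ℂ, ((m ‖ζ‖ : ℝ) : ℂ) := by
    refine integral_congr_ae ?_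
    have : ∀ᵐ ζ : ℂ, ζ ≠ 0 := by simp [ae_iff]
    filter_upwards [this] with ζ hζ
    rw [dbar_radialCutoff, mul_assoc, mul_inv_cancel₀ hζ, mul_one]
  rw [h1, integral_complex_ofReal, integral_fun_norm_addHaar volume m]
  -- In polar coordinates the radial integrand is the derivative of the cutoff profile, which drops
  -- from 1 to 0.
  have h2 : ∫ y in Ioi (0 : ℝ), y ^ (Module.finrank ℝ ℂ - 1) • m y = -1 := by
    have h3 : ∀ y : ℝ, HasDerivAt (fun y => Real.smoothTransition (2 - 4 * y ^ 2 / ρ ^ 2))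
        (y * m y) y := by
      intro y
      have h3 : HasDerivAt Real.smoothTransition
          (deriv Real.smoothTransition (2 - 4 * y ^ 2 / ρ ^ 2)) (2 - 4 * y ^ 2 / ρ ^ 2) :=
        ((Real.smoothTransition.contDiff (n := 1)).differentiable one_ne_zero _).hasDerivAt
      have h4 : HasDerivAt (fun y : ℝ => 2 - 4 * y ^ 2 / ρ ^ 2) (-8 / ρ ^ 2 * y) y := by
        have := (((hasDerivAt_id y).pow 2).const_mul (-4 / ρ ^ 2)).const_add 2
        refine (this.congr_of_eventuallyEq (Eventually.of_forall fun x => ?_)).congr_deriv ?_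
        · simp
          ring
        · simp
          ring
      refine (h3.comp y h4).congr_deriv ?_
      simp only [hm]
      ring
    have h5 := integral_Ioi_of_hasDerivAt_of_nonpos' (a := 0) (l := 0) (fun x _ => h3 x)
      (fun x hx => ?_) ?_
    · simp only [Complex.finrank_real_complex, smul_eq_mul]
      norm_num
      rw [h5, Real.smoothTransition.one_of_one_le (by norm_num)]
      norm_num
    · have hd : 0 ≤ deriv Real.smoothTransition (2 - 4 * x ^ 2 / ρ ^ 2) :=
        Real.smoothTransition.monotone.deriv_nonneg
      have hx' : 0 ≤ x := (mem_Ioi.1 hx).le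
      have : m x ≤ 0 := by
        simp only [hm]
        refine mul_nonpos_of_nonneg_of_nonpos hd ?_
        rw [div_nonpos_iff]
        exact Or.inr ⟨by norm_num, by positivity⟩
      exact mul_nonpos_of_nonneg_of_nonpos hx' this
    · refine tendsto_const_nhds.congr' ?_
      filter_upwards [eventually_ge_atTop ρ] with y hy
      refine (Real.smoothTransition.zero_of_nonpos ?_).symm
      have : 4 ≤ 4 * y ^ 2 / ρ ^ 2 := by
        rw [le_div_iff₀ (by positivity)]
        nlinarith
      linarith
  have h6 : (volume : Measure ℂ).real (ball 0 1) = Real.pi := by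
    simp [Measure.real, Complex.volume_ball]
  rw [h2, h6, Complex.finrank_real_complex]
  simp

theorem tsupport_sub_radialCutoff_subset {η : ℂ → ℝ} {ρ : ℝ} (hρ : 0 < ρ)
    (h1 : ∀ ζ ∈ ball (0 : ℂ) ρ, η ζ = 1) :
    tsupport (fun ζ => η ζ - radialCutoff ρ ζ) ⊆ tsupport η \ ball 0 (ρ / 2) := by
  have hball : ball (0 : ℂ) ρ ⊆ tsupport η := fun ζ hζ =>
    subset_tsupport η (by simp [h1 ζ hζ])
  refine closure_minimal (fun ζ hζ => ⟨?_, fun hb => hζ ?_⟩)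
    ((isClosed_tsupport η).sdiff isOpen_ball)
  · by_contra hn
    refine hζ ?_
    have hn' : ζ ∉ tsupport (radialCutoff ρ) := fun h =>
      hn (hball (tsupport_radialCutoff_subset hρ h))
    simp [image_eq_zero_of_notMem_tsupport hn, image_eq_zero_of_notMem_tsupport hn']
  · have hb' := mem_ball_zero_iff.1 hb
    have : ζ ∈ ball (0 : ℂ) ρ := mem_ball_zero_iff.2 (by linarith)
    simp [h1 ζ this, radialCutoff_eq_one hρ hb'.le]

/-- The Cauchy–Pompeiu formula `-(2π)⁻¹ ∫ 2 (∂η/∂ζ̄) h(ζ)/ζ = h(0)` for a cutoff function `η`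
that is one near the origin. -/
theorem integral_dbar_mul_div_eq {η : ℂ → ℝ} {h : ℂ → ℂ} {M ρ : ℝ} (hη : ContDiff ℝ 1 η)
    (hM : ∀ ζ, ‖η ζ‖ ≤ M) (hM' : ∀ ζ, ‖fderiv ℝ η ζ‖ ≤ M) (hρ : 0 < ρ)
    (h1 : ∀ ζ ∈ ball (0 : ℂ) ρ, η ζ = 1)
    (hh : ∀ ζ ∈ tsupport η, DifferentiableAt ℂ h ζ)
    (hi : IntegrableOn (fun ζ => h ζ / ζ) (tsupport η \ ball 0 (ρ / 2)))
    (hi' : IntegrableOn (deriv fun ζ => h ζ / ζ) (tsupport η \ ball 0 (ρ / 2))) :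
    ∫ ζ, dbar η ζ * (h ζ / ζ) = -(2 * Real.pi) * h 0 := by
  have hball : ball (0 : ℂ) ρ ⊆ tsupport η := fun ζ hζ =>
    subset_tsupport η (by simp [h1 ζ hζ])
  set φ := radialCutoff ρ with hφ
  have hφ1 : ContDiff ℝ 1 φ := contDiff_radialCutoff ρ
  have hφc : HasCompactSupport φ := hasCompactSupport_radialCutoff hρ
  obtain ⟨M₁, hM₁⟩ := hφ1.continuous.bounded_above_of_compact_support hφc
  obtain ⟨M₂, hM₂⟩ := (hφ1.continuous_fderiv one_ne_zero).bounded_above_of_compact_support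
    (hφc.fderiv (𝕜 := ℝ))
  have hTφ : tsupport φ ⊆ ball 0 ρ := tsupport_radialCutoff_subset hρ
  have hsub := tsupport_sub_radialCutoff_subset hρ h1
  -- the difference of the cutoffs
  have hD : ContDiff ℝ 1 fun ζ => η ζ - φ ζ := hη.sub hφ1
  have hDi := hi.mono_set hsub
  have hDi' := hi'.mono_set hsub
  have hDM : ∀ ζ, ‖η ζ - φ ζ‖ ≤ M + max M₁ M₂ := fun ζ =>
    (norm_sub_le _ _).trans (add_le_add (hM ζ) ((hM₁ ζ).trans (le_max_left _ _)))
  have hDM' : ∀ ζ, ‖fderiv ℝ (fun ζ => η ζ - φ ζ) ζ‖ ≤ M + max M₁ M₂ := fun ζ => by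
    rw [fderiv_fun_sub (hη.differentiable one_ne_zero ζ) (hφ1.differentiable one_ne_zero ζ)]
    exact (norm_sub_le _ _).trans (add_le_add (hM' ζ) ((hM₂ ζ).trans (le_max_right _ _)))
  have hS1 := integral_dbar_mul_eq_zero hD hDM hDM' (g := fun ζ => h ζ / ζ)
    (fun ζ hζ => (hh ζ (hsub hζ).1).div differentiableAt_id (by
      rintro rfl
      exact (hsub hζ).2 (mem_ball_self (by positivity)))) hDi hDi'
  have hI1 : Integrable fun ζ => dbar (fun ζ => η ζ - φ ζ) ζ * (h ζ / ζ) :=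
    integrable_mul_of_integrableOn (isClosed_tsupport _) (continuous_dbar hD)
      (fun ζ => norm_dbar_le (hDM' ζ)) (fun ζ => dbar_eq_zero_of_notMem) hDi
  -- the radial cutoff
  set k := dslope h 0 with hk
  have hkd : DifferentiableOn ℂ k (ball 0 ρ) :=
    (Complex.differentiableOn_dslope (ball_mem_nhds 0 hρ)).2 fun ζ hζ =>
      (hh ζ (hball hζ)).differentiableWithinAt
  have hkd' : DifferentiableOn ℂ (deriv k) (ball 0 ρ) := hkd.deriv isOpen_ball
  have hki : IntegrableOn k (tsupport φ) :=
    (hkd.continuousOn.mono hTφ).integrableOn_compact hφc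
  have hS2 := integral_dbar_mul_eq_zero hφ1 (fun ζ => (hM₁ ζ).trans (le_max_left M₁ M₂))
    (fun ζ => (hM₂ ζ).trans (le_max_right M₁ M₂)) (g := k)
    (fun ζ hζ => hkd.differentiableAt (isOpen_ball.mem_nhds (hTφ hζ))) hki
    ((hkd'.continuousOn.mono hTφ).integrableOn_compact hφc)
  have hI2 : Integrable fun ζ => dbar φ ζ * k ζ :=
    integrable_mul_of_integrableOn (isClosed_tsupport _) (continuous_dbar hφ1)
      (fun ζ => norm_dbar_le (hM₂ ζ)) (fun ζ => dbar_eq_zero_of_notMem) hki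
  have hc := integral_dbar_radialCutoff_div hρ
  -- A non-integrable function would have integral 0 by convention, but the integral is −2π.
  have hI3 : Integrable fun ζ => dbar φ ζ * ζ⁻¹ := by
    by_contra hn
    rw [integral_undef hn] at hc
    have hpi : (Real.pi : ℂ) ≠ 0 := by exact_mod_cast Real.pi_ne_zero
    simp [hpi] at hc
  have hne : ∀ᵐ ζ : ℂ, ζ ≠ 0 := by simp [ae_iff]
  -- Write η = (η − φ) + φ and, for φ, h(ζ)/ζ = h(0)/ζ + k(ζ) with k holomorphic. Stokes' theorem
  -- kills all but the term h(0)/ζ.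
  calc ∫ ζ, dbar η ζ * (h ζ / ζ)
      = ∫ ζ, (dbar (fun ζ => η ζ - φ ζ) ζ * (h ζ / ζ) +
          ((h 0) * (dbar φ ζ * ζ⁻¹) + dbar φ ζ * k ζ)) := by
        refine integral_congr_ae ?_
        filter_upwards [hne] with ζ hζ
        rw [dbar_sub (hη.differentiable one_ne_zero ζ) (hφ1.differentiable one_ne_zero ζ), hk,
          dslope_of_ne _ hζ, slope_def_field]
        field_simp
        ring
    _ = -(2 * Real.pi) * h 0 := by
        have hI4 : Integrable fun ζ => h 0 * (dbar φ ζ * ζ⁻¹) + dbar φ ζ * k ζ :=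
          (hI3.const_mul _).add hI2
        rw [integral_add hI1 hI4, integral_add (hI3.const_mul _) hI2, hS1, hS2, integral_const_mul, hc]
        ring

/-- The Gaussian decay of `exp (ζ²)` on vertical strips. -/
theorem norm_cexp_sq_le {ζ : ℂ} {L : ℝ} (h : |ζ.re| ≤ L) :
    ‖cexp (ζ ^ 2)‖ ≤ Real.exp (2 * L ^ 2) * Real.exp (-‖ζ‖ ^ 2) := by
  rw [norm_exp, ← Real.exp_add]
  refine Real.exp_le_exp.2 ?_
  have h1 : (ζ ^ 2).re = 2 * ζ.re ^ 2 - ‖ζ‖ ^ 2 := by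
    rw [← normSq_eq_norm_sq, normSq_apply, sq, mul_re]
    ring
  have h2 : ζ.re ^ 2 ≤ L ^ 2 := sq_le_sq' (abs_le.1 h).1 (abs_le.1 h).2
  rw [h1]
  linarith

theorem integrable_gaussian_plane : Integrable fun ζ : ℂ => Real.exp (-‖ζ‖ ^ 2) := by
  have := (GaussianFourier.integrable_cexp_neg_mul_sq_norm_add (V := ℂ) (b := 1) (by simp) 0 0).norm
  refine this.congr (Eventually.of_forall fun ζ => ?_)
  simp only [norm_exp]
  norm_cast
  simp

end PlaneCauchyRiemann

/-! ### Cutoffs around a possibly unbounded closed set. -/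

section Cutoff

open Metric Set Filter Topology

/-- `X` is a `C¹` cutoff function with bounded derivative, equal to one at distance at most `α`
from `E` and to zero at distance at least `β`. -/
structure IsCutoff {n : ℕ} (E : Set (Cn n)) (α β M : ℝ) (X : Cn n → ℝ) : Prop where
  contDiff : ContDiff ℝ 1 X
  norm_le : ∀ y, ‖X y‖ ≤ M
  norm_fderiv_le : ∀ y, ‖fderiv ℝ X y‖ ≤ M
  eq_one : ∀ y, infDist y E ≤ α → X y = 1
  eq_zero : ∀ y, β ≤ infDist y E → X y = 0

/-- The indicator of a neighbourhood of E is mollified. The bounds are the L¹ norms of the mollifier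
and of its derivative, so no compactness of E is needed. -/
theorem exists_isCutoff {n : ℕ} (E : Set (Cn n)) {α β : ℝ} (h : α < β) :
    ∃ M X, IsCutoff E α β M X := by
  set γ : ℝ := (α + β) / 2 with hγ
  set T : Set (Cn n) := {y | infDist y E ≤ γ} with hT
  have hTm : MeasurableSet T := (isClosed_le (continuous_infDist_pt E) continuous_const).measurableSet
  set g : Cn n → ℝ := T.indicator fun _ => 1 with hg
  have hgm : Measurable g := measurable_const.indicator hTm
  have hg1 : ∀ y, ‖g y‖ ≤ 1 := fun y => by
    by_cases hy : y ∈ T <;> simp [hg, hy]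
  have hgl : LocallyIntegrable g volume :=
    (locallyIntegrable_const (1 : ℝ)).mono hgm.aestronglyMeasurable
      (Eventually.of_forall fun y => by simpa using hg1 y)
  -- The outer radius is less than half of β − α, so a ball about a point at distance at most α, or
  -- at least β, stays on one side of the level γ.
  let φ : ContDiffBump (0 : Cn n) := ⟨(β - α) / 8, (β - α) / 4, by linarith, by linarith⟩
  have hφr : φ.rOut = (β - α) / 4 := rfl
  set p : Cn n → ℝ := φ.normed volume with hp
  have hpc : HasCompactSupport p := φ.hasCompactSupport_normed
  have hps : ContDiff ℝ 1 p := φ.contDiff_normed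
  set X : Cn n → ℝ := convolution p g (ContinuousLinearMap.lsmul ℝ ℝ) volume with hX
  have hder : ∀ y, HasFDerivAt X
      (convolution (fderiv ℝ p) g ((ContinuousLinearMap.lsmul ℝ ℝ).precompL (Cn n)) volume y) y :=
    fun y => hpc.hasFDerivAt_convolution_left _ hps hgl y
  have hpi : Integrable p := hps.continuous.integrable_of_hasCompactSupport hpc
  have hpi' : Integrable (fderiv ℝ p) :=
    (hps.continuous_fderiv one_ne_zero).integrable_of_hasCompactSupport (hpc.fderiv (𝕜 := ℝ))
  have hb1 : ∀ y, ‖X y‖ ≤ ∫ t, ‖p t‖ := fun y => by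
    refine norm_integral_le_of_norm_le hpi.norm (Eventually.of_forall fun t => ?_)
    simp only [ContinuousLinearMap.lsmul_apply, smul_eq_mul, norm_mul]
    exact mul_le_of_le_one_right (norm_nonneg _) (hg1 _)
  have hb2 : ∀ y, ‖fderiv ℝ X y‖ ≤ ∫ t, ‖fderiv ℝ p t‖ := fun y => by
    rw [(hder y).fderiv]
    refine norm_integral_le_of_norm_le hpi'.norm (Eventually.of_forall fun t => ?_)
    refine ContinuousLinearMap.opNorm_le_bound _ (norm_nonneg _) fun v => ?_
    rw [ContinuousLinearMap.precompL_apply, ContinuousLinearMap.lsmul_apply, smul_eq_mul, norm_mul]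
    exact (mul_le_of_le_one_right (norm_nonneg _) (hg1 _)).trans
      (ContinuousLinearMap.le_opNorm _ _)
  have hdist : ∀ y x, x ∈ ball y φ.rOut → |infDist x E - infDist y E| < (β - α) / 4 := by
    intro y x hx
    have h1 := infDist_le_infDist_add_dist (s := E) (x := x) (y := y)
    have h2 := infDist_le_infDist_add_dist (s := E) (x := y) (y := x)
    have h3 : dist x y < (β - α) / 4 := hx
    rw [dist_comm] at h2
    rw [abs_lt]
    constructor <;> linarith
  refine ⟨max (∫ t, ‖p t‖) (∫ t, ‖fderiv ℝ p t‖), X,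
    hpc.contDiff_convolution_left _ hps hgl, fun y => (hb1 y).trans (le_max_left _ _),
    fun y => (hb2 y).trans (le_max_right _ _), fun y hy => ?_, fun y hy => ?_⟩
  · have hval : ∀ x ∈ ball y φ.rOut, g x = 1 := fun x hx => by
      have h1 := abs_lt.1 (hdist y x hx)
      have hx : x ∈ T := by
        change infDist x E ≤ γ
        linarith [h1.2]
      simp [hg, hx]
    have hy1 : g y = 1 := hval y (mem_ball_self φ.rOut_pos)
    rw [hX, ← hy1]
    exact φ.normed_convolution_eq_right fun x hx => by rw [hval x hx, hy1]
  · have hval : ∀ x ∈ ball y φ.rOut, g x = 0 := fun x hx => by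
      have h1 := abs_lt.1 (hdist y x hx)
      have hx : x ∉ T := by
        change ¬ (infDist x E ≤ γ)
        linarith [h1.1]
      simp [hg, hx]
    have hy1 : g y = 0 := hval y (mem_ball_self φ.rOut_pos)
    rw [hX, ← hy1]
    exact φ.normed_convolution_eq_right fun x hx => by rw [hval x hx, hy1]

end Cutoff

/-! ### Integrals along complex lines of direction a. -/

section SliceTransform

open Metric Set Filter Topology Complex

/-- `f` is holomorphic and bounded together with its derivative on `S`, and the slices of `S` by
complex lines of direction `a` are contained in vertical strips, as seen by the linear form `ℓ`. -/
structure IsBoundedOnShell {n : ℕ} (f : Cn n → ℂ) (S : Set (Cn n)) (a : Cn n)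
    (ℓ : Cn n → ℝ) (L B : ℝ) : Prop where
  nonneg : 0 ≤ B
  measurable : Measurable f
  differentiableAt : ∀ y ∈ S, DifferentiableAt ℂ f y
  norm_le : ∀ y ∈ S, ‖f y‖ ≤ B
  norm_fderiv_le : ∀ y ∈ S, ‖fderiv ℂ f y‖ ≤ B
  norm_dir : ‖a‖ = 1
  form_add : ∀ (y : Cn n) (ζ : ℂ), ℓ (y + ζ • a) = ℓ y + ζ.re
  form_le : ∀ y ∈ S, |ℓ y| ≤ L

variable {n : ℕ} {f : Cn n → ℂ} {S : Set (Cn n)} {a : Cn n} {ℓ : Cn n → ℝ} {L B : ℝ}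

namespace IsBoundedOnShell

theorem abs_re_le (h : IsBoundedOnShell f S a ℓ L B) {z : Cn n} {ζ : ℂ} (hζ : z + ζ • a ∈ S) :
    |ζ.re| ≤ L + |ℓ z| := by
  have h1 := h.form_le _ hζ
  rw [h.form_add] at h1
  calc |ζ.re| = |(ℓ z + ζ.re) - ℓ z| := by ring_nf
    _ ≤ |ℓ z + ζ.re| + |ℓ z| := abs_sub _ _
    _ ≤ L + |ℓ z| := by linarith

theorem hasDerivAt_slice (h : IsBoundedOnShell f S a ℓ L B) {z : Cn n} {ζ : ℂ}
    (hζ : z + ζ • a ∈ S) :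
    HasDerivAt (fun ζ : ℂ => f (z + ζ • a)) (fderiv ℂ f (z + ζ • a) a) ζ := by
  have h2 : HasDerivAt (fun ζ : ℂ => z + ζ • a) a ζ := by
    simpa using ((hasDerivAt_id ζ).smul_const a).const_add z
  exact (h.differentiableAt _ hζ).hasFDerivAt.comp_hasDerivAt ζ h2

/-- The strip condition gives Gaussian decay; this replaces compactness of the slices. -/
theorem norm_slice_le (h : IsBoundedOnShell f S a ℓ L B) {z : Cn n} {ζ : ℂ} {c : ℝ} (hc : 0 < c)
    (hζ : z + ζ • a ∈ S) (hcζ : c ≤ ‖ζ‖) : ‖f (z + ζ • a) * cexp (ζ ^ 2) / ζ‖ ≤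
      B * Real.exp (2 * (L + |ℓ z|) ^ 2) / c * Real.exp (-‖ζ‖ ^ 2) := by
  have h1 := h.norm_le _ hζ
  have h2 := norm_cexp_sq_le (h.abs_re_le hζ)
  have hB : 0 ≤ B := (norm_nonneg _).trans h1
  rw [norm_div, norm_mul]
  calc ‖f (z + ζ • a)‖ * ‖cexp (ζ ^ 2)‖ / ‖ζ‖
      ≤ B * (Real.exp (2 * (L + |ℓ z|) ^ 2) * Real.exp (-‖ζ‖ ^ 2)) / c := by gcongr
    _ = _ := by ring

theorem measurable_slice (h : IsBoundedOnShell f S a ℓ L B) (z : Cn n) :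
    Measurable fun ζ : ℂ => f (z + ζ • a) * cexp (ζ ^ 2) / ζ := by
  have h1 : Measurable fun ζ : ℂ => f (z + ζ • a) :=
    h.measurable.comp (by fun_prop : Continuous fun ζ : ℂ => z + ζ • a).measurable
  have h2 : Measurable fun ζ : ℂ => cexp (ζ ^ 2) :=
    (by fun_prop : Continuous fun ζ : ℂ => cexp (ζ ^ 2)).measurable
  exact (h1.mul h2).div measurable_id

theorem integrableOn_slice (h : IsBoundedOnShell f S a ℓ L B) {z : Cn n} {c : ℝ} (hc : 0 < c)
    {T : Set ℂ} (hT : MeasurableSet T) (hTS : ∀ ζ ∈ T, z + ζ • a ∈ S) (hTc : ∀ ζ ∈ T, c ≤ ‖ζ‖) :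
    IntegrableOn (fun ζ : ℂ => f (z + ζ • a) * cexp (ζ ^ 2) / ζ) T :=
  Integrable.mono' (integrable_gaussian_plane.const_mul _).integrableOn
    (h.measurable_slice z).aestronglyMeasurable
    ((ae_restrict_mem hT).mono fun ζ hζ => h.norm_slice_le hc (hTS ζ hζ) (hTc ζ hζ))

theorem integrableOn_deriv_slice (h : IsBoundedOnShell f S a ℓ L B) {z : Cn n} {c : ℝ}
    (hc : 0 < c) {T : Set ℂ} (hT : MeasurableSet T) (hTS : ∀ ζ ∈ T, z + ζ • a ∈ S)
    (hTc : ∀ ζ ∈ T, c ≤ ‖ζ‖) :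
    IntegrableOn (deriv fun ζ : ℂ => f (z + ζ • a) * cexp (ζ ^ 2) / ζ) T := by
  refine Integrable.mono' ((integrable_gaussian_plane.const_mul
    (B * Real.exp (2 * (L + |ℓ z|) ^ 2) * (1 / c + 2 + 1 / c ^ 2))).integrableOn)
    (measurable_deriv _).aestronglyMeasurable ((ae_restrict_mem hT).mono fun ζ hζ => ?_)
  have hζ0 : ζ ≠ 0 := norm_pos_iff.1 (hc.trans_le (hTc ζ hζ))
  have hB : 0 ≤ B := (norm_nonneg _).trans (h.norm_le _ (hTS ζ hζ))
  have hd1 := h.hasDerivAt_slice (hTS ζ hζ)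
  have hd2 : HasDerivAt (fun ζ : ℂ => cexp (ζ ^ 2)) (cexp (ζ ^ 2) * (2 * ζ)) ζ := by
    simpa using (hasDerivAt_pow 2 ζ).cexp
  have hd : HasDerivAt (fun ζ : ℂ => f (z + ζ • a) * cexp (ζ ^ 2) / ζ) _ ζ :=
    (hd1.mul hd2).div (hasDerivAt_id ζ) hζ0
  rw [hd.deriv]
  have hE := norm_cexp_sq_le (h.abs_re_le (hTS ζ hζ))
  set G := Real.exp (2 * (L + |ℓ z|) ^ 2) * Real.exp (-‖ζ‖ ^ 2) with hG
  have hG0 : 0 ≤ G := by positivity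
  have hf1 := h.norm_le _ (hTS ζ hζ)
  have hf2 : ‖fderiv ℂ f (z + ζ • a) a‖ ≤ B := by
    simpa [h.norm_dir] using (fderiv ℂ f (z + ζ • a)).le_of_opNorm_le
      (h.norm_fderiv_le _ (hTS ζ hζ)) a
  have hcz := hTc ζ hζ
  have heq : ((fderiv ℂ f (z + ζ • a) a * cexp (ζ ^ 2) +
        f (z + ζ • a) * (cexp (ζ ^ 2) * (2 * ζ))) * ζ - f (z + ζ • a) * cexp (ζ ^ 2) * 1) / ζ ^ 2
      = fderiv ℂ f (z + ζ • a) a * cexp (ζ ^ 2) / ζ + f (z + ζ • a) * cexp (ζ ^ 2) * 2 -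
        f (z + ζ • a) * cexp (ζ ^ 2) / ζ ^ 2 := by
    field_simp
  have h1 : ‖fderiv ℂ f (z + ζ • a) a * cexp (ζ ^ 2) / ζ‖ ≤ B * G / c := by
    rw [norm_div, norm_mul]
    gcongr
  have h2 : ‖f (z + ζ • a) * cexp (ζ ^ 2) * 2‖ ≤ B * G * 2 := by
    rw [norm_mul, norm_mul, Complex.norm_two]
    gcongr
  have h3 : ‖f (z + ζ • a) * cexp (ζ ^ 2) / ζ ^ 2‖ ≤ B * G / c ^ 2 := by
    rw [norm_div, norm_mul, norm_pow]
    gcongr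
  simp only [Pi.mul_apply]
  rw [heq]
  calc _ ≤ B * G / c + B * G * 2 + B * G / c ^ 2 :=
        (norm_sub_le _ _).trans (add_le_add ((norm_add_le _ _).trans (add_le_add h1 h2)) h3)
    _ = _ := by
        rw [hG]
        ring

theorem integrable_dbar_slice (h : IsBoundedOnShell f S a ℓ L B) {η : ℂ → ℝ} {M : ℝ}
    (hη : ContDiff ℝ 1 η) (hM : ∀ ζ, ‖fderiv ℝ η ζ‖ ≤ M) {z : Cn n} {c : ℝ} (hc : 0 < c)
    {T : Set ℂ} (hT : IsClosed T) (hT0 : ∀ ζ ∉ T, dbar η ζ = 0)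
    (hTS : ∀ ζ ∈ T, z + ζ • a ∈ S) (hTc : ∀ ζ ∈ T, c ≤ ‖ζ‖) :
    Integrable fun ζ : ℂ => dbar η ζ * (f (z + ζ • a) * cexp (ζ ^ 2) / ζ) :=
  integrable_mul_of_integrableOn hT (continuous_dbar hη) (fun ζ => norm_dbar_le (hM ζ)) hT0
    (h.integrableOn_slice hc hT.measurableSet hTS hTc)

theorem integral_dbar_slice_eq_zero (h : IsBoundedOnShell f S a ℓ L B) {η : ℂ → ℝ} {M : ℝ}
    (hη : ContDiff ℝ 1 η) (hM : ∀ ζ, ‖η ζ‖ ≤ M) (hM' : ∀ ζ, ‖fderiv ℝ η ζ‖ ≤ M) {z : Cn n} {c : ℝ}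
    (hc : 0 < c) (hS : ∀ ζ ∈ tsupport η, z + ζ • a ∈ S) (hηc : ∀ ζ ∈ tsupport η, c ≤ ‖ζ‖) :
    ∫ ζ : ℂ, dbar η ζ * (f (z + ζ • a) * cexp (ζ ^ 2) / ζ) = 0 := by
  have hTm : MeasurableSet (tsupport η) := (isClosed_tsupport η).measurableSet
  refine integral_dbar_mul_eq_zero hη hM hM' (fun ζ hζ => ?_)
    (h.integrableOn_slice hc hTm hS hηc) (h.integrableOn_deriv_slice hc hTm hS hηc)
  refine ((h.hasDerivAt_slice (hS ζ hζ)).differentiableAt.mul (by fun_prop)).div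
    differentiableAt_id (norm_pos_iff.1 (hc.trans_le (hηc ζ hζ)))

theorem integral_dbar_slice_eq (h : IsBoundedOnShell f S a ℓ L B) {η : ℂ → ℝ} {M ρ : ℝ}
    (hη : ContDiff ℝ 1 η) (hM : ∀ ζ, ‖η ζ‖ ≤ M) (hM' : ∀ ζ, ‖fderiv ℝ η ζ‖ ≤ M) {z : Cn n}
    (hρ : 0 < ρ) (h1 : ∀ ζ ∈ ball (0 : ℂ) ρ, η ζ = 1)
    (hS : ∀ ζ ∈ tsupport η, z + ζ • a ∈ S) :
    ∫ ζ : ℂ, dbar η ζ * (f (z + ζ • a) * cexp (ζ ^ 2) / ζ) = -(2 * Real.pi) * f z := by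
  have hTm : MeasurableSet (tsupport η \ ball 0 (ρ / 2)) :=
    (isClosed_tsupport η).measurableSet.diff measurableSet_ball
  have hS' : ∀ ζ ∈ tsupport η \ ball 0 (ρ / 2), z + ζ • a ∈ S := fun ζ hζ => hS ζ hζ.1
  have hc' : ∀ ζ ∈ tsupport η \ ball 0 (ρ / 2), ρ / 2 ≤ ‖ζ‖ := fun ζ hζ => by
    simpa using hζ.2
  have := integral_dbar_mul_div_eq (h := fun ζ => f (z + ζ • a) * cexp (ζ ^ 2)) hη hM hM' hρ h1
    (fun ζ hζ => (h.hasDerivAt_slice (hS ζ hζ)).differentiableAt.mul (by fun_prop))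
    (h.integrableOn_slice (half_pos hρ) hTm hS' hc')
    (h.integrableOn_deriv_slice (half_pos hρ) hTm hS' hc')
  simpa using this

theorem differentiableAt_integral_dbar_slice (h : IsBoundedOnShell f S a ℓ L B) {η : ℂ → ℝ}
    {M : ℝ} (hη : ContDiff ℝ 1 η) (hM' : ∀ ζ, ‖fderiv ℝ η ζ‖ ≤ M) {w : Cn n} {c δ : ℝ}
    (hc : 0 < c) (hδ : 0 < δ) {T : Set ℂ} (hT : IsClosed T) (hT0 : ∀ ζ ∉ T, dbar η ζ = 0)
    (hTS : ∀ z ∈ ball w δ, ∀ ζ ∈ T, z + ζ • a ∈ S) (hTc : ∀ ζ ∈ T, c ≤ ‖ζ‖) :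
    DifferentiableAt ℂ
      (fun z => ∫ ζ : ℂ, dbar η ζ * (f (z + ζ • a) * cexp (ζ ^ 2) / ζ)) w := by
  have hw : w ∈ ball w δ := mem_ball_self hδ
  have hk : Measurable fun ζ : ℂ => dbar η ζ * (cexp (ζ ^ 2) / ζ) :=
    (continuous_dbar hη).measurable.mul
      ((by fun_prop : Continuous fun ζ : ℂ => cexp (ζ ^ 2)).measurable.div measurable_id)
  refine (hasFDerivAt_integral_of_dominated_of_fderiv_le (μ := volume) (s := ball w δ)
    (F := fun z ζ => dbar η ζ * (f (z + ζ • a) * cexp (ζ ^ 2) / ζ))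
    (F' := fun z ζ => (dbar η ζ * (cexp (ζ ^ 2) / ζ)) • fderiv ℂ f (z + ζ • a))
    (bound := fun ζ => 2 * M * (Real.exp (2 * (L + |ℓ w|) ^ 2) / c * B) * Real.exp (-‖ζ‖ ^ 2))
    (isOpen_ball.mem_nhds hw)
    (Eventually.of_forall fun z => ((continuous_dbar hη).measurable.mul
      (h.measurable_slice z)).aestronglyMeasurable)
    (h.integrable_dbar_slice hη hM' hc hT hT0 (hTS w hw) hTc) ?_ ?_
    (integrable_gaussian_plane.const_mul _) ?_).differentiableAt
  · refine AEStronglyMeasurable.smul hk.aestronglyMeasurable ?_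
    exact ((measurable_fderiv ℂ f).comp
      (by fun_prop : Continuous fun ζ : ℂ => w + ζ • a).measurable).aestronglyMeasurable
  · refine Eventually.of_forall fun ζ z hz => ?_
    by_cases hζ : ζ ∈ T
    · have h1 := norm_dbar_le (hM' ζ)
      -- As T does not depend on z, the strip seen from w serves for all nearby z.
      have h2 := norm_cexp_sq_le (h.abs_re_le (hTS w hw ζ hζ))
      have h3 := h.norm_fderiv_le _ (hTS z hz ζ hζ)
      have h4 := hTc ζ hζ
      have hB : 0 ≤ B := (norm_nonneg _).trans h3
      rw [norm_smul, norm_mul, norm_div]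
      calc ‖dbar η ζ‖ * (‖cexp (ζ ^ 2)‖ / ‖ζ‖) * ‖fderiv ℂ f (z + ζ • a)‖
          ≤ 2 * M * (Real.exp (2 * (L + |ℓ w|) ^ 2) * Real.exp (-‖ζ‖ ^ 2) / c) * B := by
            have hM0 : 0 ≤ 2 * M := (norm_nonneg _).trans h1
            gcongr
        _ = _ := by ring
    · have hM0 : 0 ≤ M := (norm_nonneg _).trans (hM' 0)
      have hB := h.nonneg
      have h0 : (dbar η ζ * (cexp (ζ ^ 2) / ζ)) • fderiv ℂ f (z + ζ • a) = 0 := by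
        ext v
        simp [hT0 ζ hζ]
      rw [h0, norm_zero]
      positivity
  · refine Eventually.of_forall fun ζ z hz => ?_
    by_cases hζ : ζ ∈ T
    · have h1 := (h.differentiableAt _ (hTS z hz ζ hζ)).hasFDerivAt
      have h2 : HasFDerivAt (fun z : Cn n => z + ζ • a) (ContinuousLinearMap.id ℂ (Cn n)) z :=
        (hasFDerivAt_id z).add_const _
      have h3 := (h1.comp z h2).const_mul (dbar η ζ * (cexp (ζ ^ 2) / ζ))
      refine (h3.congr_of_eventuallyEq (Eventually.of_forall fun x => ?_))
      simp only [Function.comp]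
      ring
    · have h0 : (dbar η ζ * (cexp (ζ ^ 2) / ζ)) • fderiv ℂ f (z + ζ • a) = 0 := by
        ext v
        simp [hT0 ζ hζ]
      rw [h0]
      simp only [hT0 ζ hζ, zero_mul]
      exact hasFDerivAt_const _ _

end IsBoundedOnShell

end SliceTransform

/-! ### The slice transform: holomorphy, jump and vanishing. -/

section CutoffTransform

open Metric Set Filter Topology Complex

variable {n : ℕ} {E : Set (Cn n)} {X Y : Cn n → ℝ} {α β α' β' M M' : ℝ} {a : Cn n}

theorem abs_infDist_sub_infDist_le (E : Set (Cn n)) (x y : Cn n) :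
    |infDist x E - infDist y E| ≤ dist x y := by
  have h1 := infDist_le_infDist_add_dist (s := E) (x := x) (y := y)
  have h2 := infDist_le_infDist_add_dist (s := E) (x := y) (y := x)
  rw [dist_comm] at h2
  rw [abs_le]
  constructor <;> linarith

theorem abs_infDist_slice_sub_le (E : Set (Cn n)) (ha : ‖a‖ = 1) (z : Cn n) (ζ : ℂ) :
    |infDist (z + ζ • a) E - infDist z E| ≤ ‖ζ‖ := by
  refine (abs_infDist_sub_infDist_le E _ _).trans_eq ?_
  rw [dist_eq_norm, add_sub_cancel_left, norm_smul, ha, mul_one]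

namespace IsCutoff

theorem contDiff_slice (hX : IsCutoff E α β M X) (a z : Cn n) :
    ContDiff ℝ 1 fun ζ : ℂ => X (z + ζ • a) :=
  hX.contDiff.comp (by fun_prop)

theorem norm_fderiv_slice_le (hX : IsCutoff E α β M X) (ha : ‖a‖ = 1) (z : Cn n) (ζ : ℂ) :
    ‖fderiv ℝ (fun ζ : ℂ => X (z + ζ • a)) ζ‖ ≤ M := by
  have h1 : HasFDerivAt (fun ζ : ℂ => z + ζ • a)
      (((ContinuousLinearMap.toSpanSingleton ℂ a).restrictScalars ℝ : ℂ →L[ℝ] Cn n)) ζ := by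
    have := (((ContinuousLinearMap.toSpanSingleton ℂ a).restrictScalars ℝ).hasFDerivAt
      (x := ζ)).const_add z
    simpa using this
  have h2 := (hX.contDiff.differentiable one_ne_zero (z + ζ • a)).hasFDerivAt.comp ζ h1
  have h3 : HasFDerivAt (fun ζ : ℂ => X (z + ζ • a)) _ ζ := h2
  rw [h3.fderiv]
  have hM0 : 0 ≤ M := (norm_nonneg _).trans (hX.norm_le 0)
  refine ContinuousLinearMap.opNorm_le_bound _ hM0 fun v => ?_
  have := (fderiv ℝ X (z + ζ • a)).le_of_opNorm_le (hX.norm_fderiv_le (z + ζ • a)) (v • a)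
  simpa [norm_smul, ha] using this

theorem dbar_slice_eq_zero (hX : IsCutoff E α β M X) {z : Cn n} {ζ : ℂ}
    (h : infDist (z + ζ • a) E ∉ Icc α β) : dbar (fun ζ : ℂ => X (z + ζ • a)) ζ = 0 := by
  have hc : Continuous fun ζ : ℂ => infDist (z + ζ • a) E :=
    (continuous_infDist_pt E).comp (by fun_prop)
  have key : ∀ c : ℝ, (∀ᶠ x in 𝓝 ζ, X (z + x • a) = c) →
      dbar (fun ζ : ℂ => X (z + ζ • a)) ζ = 0 := by
    intro c hev
    have : fderiv ℝ (fun ζ : ℂ => X (z + ζ • a)) ζ = 0 := by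
      have h1 : (fun ζ : ℂ => X (z + ζ • a)) =ᶠ[𝓝 ζ] fun _ => c := hev
      rw [h1.fderiv_eq, fderiv_fun_const]
      rfl
    simp [dbar, this]
  rw [mem_Icc, not_and_or, not_le, not_le] at h
  rcases h with h | h
  · exact key 1 ((hc.continuousAt.eventually (gt_mem_nhds h)).mono fun x hx => hX.eq_one _ hx.le)
  · exact key 0 ((hc.continuousAt.eventually (lt_mem_nhds h)).mono fun x hx => hX.eq_zero _ hx.le)

end IsCutoff

/-- The Cauchy transform, with the kernel `exp (ζ²) / ζ`, of `f ∂X` along the complex line through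
`z` of direction `a`. -/
noncomputable def sliceTransform (f : Cn n → ℂ) (X : Cn n → ℝ) (a z : Cn n) : ℂ :=
  ∫ ζ : ℂ, dbar (fun x : ℂ => X (z + x • a)) ζ * (f (z + ζ • a) * cexp (ζ ^ 2) / ζ)

variable {f : Cn n → ℂ} {S : Set (Cn n)} {ℓ : Cn n → ℝ} {L B : ℝ}

theorem isClosed_slice_infDist (E : Set (Cn n)) (a z : Cn n) (I : Set ℝ) (hI : IsClosed I) :
    IsClosed {ζ : ℂ | infDist (z + ζ • a) E ∈ I} :=
  hI.preimage ((continuous_infDist_pt E).comp (by fun_prop))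

/-- The slice transform is holomorphic away from the support of the derivative of the cutoff. -/
theorem differentiableAt_sliceTransform (h : IsBoundedOnShell f S a ℓ L B)
    (hX : IsCutoff E α β M X) {δ : ℝ} (hδ : 0 < δ)
    (hS : ∀ y, infDist y E ∈ Icc (α - δ) (β + δ) → y ∈ S) {w : Cn n}
    (hw : infDist w E ≤ α - 4 * δ ∨ β + 4 * δ ≤ infDist w E) :
    DifferentiableAt ℂ (sliceTransform f X a) w := by
  have ha := h.norm_dir
  have hfar : ∀ z ∈ ball w δ, ∀ ζ : ℂ, infDist (z + ζ • a) E ∈ Icc (α - δ) (β + δ) → δ ≤ ‖ζ‖ := by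
    intro z hz ζ hζ
    have h1 := abs_le.1 (abs_infDist_slice_sub_le E ha z ζ)
    have h2 := abs_le.1 (abs_infDist_sub_infDist_le E z w)
    have h3 : dist z w < δ := hz
    rcases hw with hw | hw
    · linarith [hζ.1, h1.2, h2.2]
    · linarith [hζ.2, h1.1, h2.1]
  have hmove : ∀ z ∈ ball w δ, ∀ ζ : ℂ,
      |infDist (z + ζ • a) E - infDist (w + ζ • a) E| < δ := by
    intro z hz ζ
    refine (abs_infDist_sub_infDist_le E _ _).trans_lt ?_
    simpa using hz
  have hw0 : w ∈ ball w δ := mem_ball_self hδ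
  set T : Set ℂ := {ζ | infDist (w + ζ • a) E ∈ Icc α β} with hT
  have hTc : IsClosed T := isClosed_slice_infDist E a w _ isClosed_Icc
  have hTS : ∀ z ∈ ball w δ, ∀ ζ ∈ T, infDist (z + ζ • a) E ∈ Icc (α - δ) (β + δ) := by
    intro z hz ζ hζ
    have h1 := abs_lt.1 (hmove z hz ζ)
    have h2 : infDist (w + ζ • a) E ∈ Icc α β := hζ
    exact ⟨by linarith [h2.1, h1.1], by linarith [h2.2, h1.2]⟩
  have hT0 : ∀ ζ ∉ T, dbar (fun x : ℂ => X (w + x • a)) ζ = 0 := fun ζ hζ =>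
    hX.dbar_slice_eq_zero hζ
  have hTδ : ∀ ζ ∈ T, δ ≤ ‖ζ‖ := fun ζ hζ => hfar w hw0 ζ (hTS w hw0 ζ hζ)
  have hηw := hX.contDiff_slice a w
  have hηw' := hX.norm_fderiv_slice_le ha w
  -- The cutoff is frozen at w, since z ↦ X(z + ζa) is not holomorphic; only f(z + ζa) then depends
  -- on z.
  have hmain := h.differentiableAt_integral_dbar_slice hηw hηw' hδ hδ hTc hT0
    (fun z hz ζ hζ => hS _ (hTS z hz ζ hζ)) hTδ
  refine hmain.congr_of_eventuallyEq ?_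
  filter_upwards [isOpen_ball.mem_nhds hw0] with z hz
  have hηz := hX.contDiff_slice a z
  have hηz' := hX.norm_fderiv_slice_le ha z
  set U : Set ℂ := {ζ | infDist (z + ζ • a) E ∈ Icc (α - δ) (β + δ)} with hU
  have hUc : IsClosed U := isClosed_slice_infDist E a z _ isClosed_Icc
  have hsupp : tsupport (fun x : ℂ => X (z + x • a) - X (w + x • a)) ⊆ U := by
    refine closure_minimal (fun ζ hζ => ?_) hUc
    by_contra hn
    refine hζ ?_
    have h1 := abs_lt.1 (hmove z hz ζ)
    have hn' : infDist (z + ζ • a) E ∉ Icc (α - δ) (β + δ) := hn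
    rw [mem_Icc, not_and_or, not_le, not_le] at hn'
    rcases hn' with hn' | hn'
    · simp only
      rw [hX.eq_one _ (by linarith), hX.eq_one _ (by linarith), sub_self]
    · simp only
      rw [hX.eq_zero _ (by linarith), hX.eq_zero _ (by linarith), sub_self]
  -- Freezing does not change the integral: the difference of the two cutoffs is supported where f
  -- is holomorphic and |ζ| ≥ δ, so Stokes' theorem applies.
  have hzero := h.integral_dbar_slice_eq_zero (M := M + M) (z := z) (hηz.sub hηw)
    (fun ζ => (norm_sub_le _ _).trans (add_le_add (hX.norm_le _) (hX.norm_le _)))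
    (fun ζ => by
      rw [fderiv_fun_sub (hηz.differentiable one_ne_zero ζ) (hηw.differentiable one_ne_zero ζ)]
      exact (norm_sub_le _ _).trans (add_le_add (hηz' ζ) (hηw' ζ)))
    hδ (fun ζ hζ => hS _ (hsupp hζ)) (fun ζ hζ => hfar z hz ζ (hsupp hζ))
  have hi1 := h.integrable_dbar_slice hηz hηz' hδ hUc (z := z)
    (fun ζ hζ => hX.dbar_slice_eq_zero fun hm => hζ
      ⟨by linarith [hm.1], by linarith [hm.2]⟩)
    (fun ζ hζ => hS _ hζ) (fun ζ hζ => hfar z hz ζ hζ)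
  have hi2 := h.integrable_dbar_slice hηw hηw' hδ hTc (z := z) hT0
    (fun ζ hζ => hS _ (hTS z hz ζ hζ)) hTδ
  rw [← sub_eq_zero, sliceTransform, ← integral_sub hi1 hi2, ← hzero]
  refine integral_congr_ae (Eventually.of_forall fun ζ => ?_)
  simp only
  rw [dbar_sub (hηz.differentiable one_ne_zero ζ) (hηw.differentiable one_ne_zero ζ), sub_mul]

/-- The jump formula: slice transforms for two cutoffs which differ by one near `z` differ by a
multiple of `f z`. -/
theorem sliceTransform_sub_sliceTransform (h : IsBoundedOnShell f S a ℓ L B)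
    (hX : IsCutoff E α β M X) (hY : IsCutoff E α' β' M' Y)
    (hS : ∀ y, infDist y E ∈ Icc α' β → y ∈ S) {z : Cn n} (hα : α' < β') (hβ : α < β)
    (hz1 : β' < infDist z E) (hz2 : infDist z E < α) :
    sliceTransform f X a z - sliceTransform f Y a z = -(2 * Real.pi) * f z := by
  have ha := h.norm_dir
  set ρ := min (infDist z E - β') (α - infDist z E) with hρ
  have hρ0 : 0 < ρ := lt_min (by linarith) (by linarith)
  have hηX := hX.contDiff_slice a z
  have hηX' := hX.norm_fderiv_slice_le ha z
  have hηY := hY.contDiff_slice a z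
  have hηY' := hY.norm_fderiv_slice_le ha z
  set U : Set ℂ := {ζ | infDist (z + ζ • a) E ∈ Icc α' β} with hU
  have hUc : IsClosed U := isClosed_slice_infDist E a z _ isClosed_Icc
  have hsupp : tsupport (fun x : ℂ => X (z + x • a) - Y (z + x • a)) ⊆ U := by
    refine closure_minimal (fun ζ hζ => ?_) hUc
    by_contra hn
    refine hζ ?_
    have hn' : infDist (z + ζ • a) E ∉ Icc α' β := hn
    rw [mem_Icc, not_and_or, not_le, not_le] at hn'
    rcases hn' with hn' | hn'
    · simp only
      rw [hX.eq_one _ (by linarith), hY.eq_one _ (by linarith), sub_self]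
    · simp only
      rw [hX.eq_zero _ (by linarith), hY.eq_zero _ (by linarith), sub_self]
  have hone : ∀ ζ ∈ ball (0 : ℂ) ρ, X (z + ζ • a) - Y (z + ζ • a) = 1 := by
    intro ζ hζ
    have h1 := abs_le.1 (abs_infDist_slice_sub_le E ha z ζ)
    have h2 : ‖ζ‖ < ρ := by simpa using hζ
    have h3 := min_le_left (infDist z E - β') (α - infDist z E)
    have h4 := min_le_right (infDist z E - β') (α - infDist z E)
    rw [hX.eq_one _ (by linarith), hY.eq_zero _ (by linarith), sub_zero]
  have hfar : ∀ ζ : ℂ, infDist (z + ζ • a) E ∈ Icc α β ∨ infDist (z + ζ • a) E ∈ Icc α' β' →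
      ρ ≤ ‖ζ‖ := by
    intro ζ hζ
    have h1 := abs_le.1 (abs_infDist_slice_sub_le E ha z ζ)
    have h3 := min_le_left (infDist z E - β') (α - infDist z E)
    have h4 := min_le_right (infDist z E - β') (α - infDist z E)
    rcases hζ with hζ | hζ
    · linarith [hζ.1]
    · linarith [hζ.2]
  have hmain := h.integral_dbar_slice_eq (M := M + M') (z := z) (hηX.sub hηY)
    (fun ζ => (norm_sub_le _ _).trans (add_le_add (hX.norm_le _) (hY.norm_le _)))
    (fun ζ => by
      rw [fderiv_fun_sub (hηX.differentiable one_ne_zero ζ) (hηY.differentiable one_ne_zero ζ)]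
      exact (norm_sub_le _ _).trans (add_le_add (hηX' ζ) (hηY' ζ)))
    hρ0 hone (fun ζ hζ => hS _ (hsupp hζ))
  have hi1 := h.integrable_dbar_slice hηX hηX' hρ0
    (isClosed_slice_infDist E a z _ (isClosed_Icc (a := α) (b := β))) (z := z)
    (fun ζ hζ => hX.dbar_slice_eq_zero hζ)
    (fun ζ hζ => hS _ ⟨by linarith [hζ.1], hζ.2⟩) (fun ζ hζ => hfar ζ (Or.inl hζ))
  have hi2 := h.integrable_dbar_slice hηY hηY' hρ0
    (isClosed_slice_infDist E a z _ (isClosed_Icc (a := α') (b := β'))) (z := z)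
    (fun ζ hζ => hY.dbar_slice_eq_zero hζ)
    (fun ζ hζ => hS _ ⟨hζ.1, by linarith [hζ.2]⟩) (fun ζ hζ => hfar ζ (Or.inr hζ))
  rw [sliceTransform, sliceTransform, ← integral_sub hi1 hi2, ← hmain]
  refine integral_congr_ae (Eventually.of_forall fun ζ => ?_)
  simp only
  rw [dbar_sub (hηX.differentiable one_ne_zero ζ) (hηY.differentiable one_ne_zero ζ), sub_mul]

/-- A line that stays farther than β from E never meets the support of the derivative of the cutoff.
-/
theorem sliceTransform_eq_zero (hX : IsCutoff E α β M X) {z : Cn n}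
    (hz : ∀ ζ : ℂ, β < infDist (z + ζ • a) E) : sliceTransform f X a z = 0 := by
  have : ∀ ζ : ℂ, dbar (fun x : ℂ => X (z + x • a)) ζ *
      (f (z + ζ • a) * cexp (ζ ^ 2) / ζ) = 0 := fun ζ => by
    rw [hX.dbar_slice_eq_zero fun hm => absurd hm.2 (not_le.2 (hz ζ)), zero_mul]
  simp [sliceTransform, this]

end CutoffTransform

/-! ### The L² bound by Schur's test. -/

section SquareEstimate

open Metric Set Filter Topology Complex

/-- Cauchy–Schwarz for F and 1 with respect to the measure of density κ. -/
theorem lintegral_mul_sq_le {α : Type*} [MeasurableSpace α] (μ : Measure α) {κ F : α → ℝ≥0∞}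
    (hκ : Measurable κ) (hF : Measurable F) :
    (∫⁻ x, κ x * F x ∂μ) ^ 2 ≤ (∫⁻ x, κ x ∂μ) * ∫⁻ x, κ x * F x ^ 2 ∂μ := by
  have h := ENNReal.lintegral_mul_le_Lp_mul_Lq (μ.withDensity κ) Real.HolderConjugate.two_two
    (f := F) (g := 1) hF.aemeasurable measurable_one.aemeasurable
  have h2 := pow_le_pow_left' h 2
  rw [mul_pow, ← ENNReal.rpow_natCast, ← ENNReal.rpow_natCast, ← ENNReal.rpow_natCast,
    ← ENNReal.rpow_mul, ← ENNReal.rpow_mul] at h2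
  norm_num at h2
  rw [lintegral_withDensity_eq_lintegral_mul _ hκ hF,
    lintegral_withDensity_eq_lintegral_mul _ hκ (hF.pow_const 2)] at h2
  rw [mul_comm]
  simpa using h2

/-- Schur's test for averages of translates along a complex direction. -/
theorem lintegral_sq_lintegral_slice_le {n : ℕ} {κ : ℂ → ℝ≥0∞} {F : Cn n → ℝ≥0∞}
    (hκ : Measurable κ) (hF : Measurable F) (a : Cn n) :
    ∫⁻ z, (∫⁻ ζ, κ ζ * F (z + ζ • a)) ^ 2 ≤ (∫⁻ ζ, κ ζ) ^ 2 * ∫⁻ y, F y ^ 2 := by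
  have hadd : Measurable fun p : Cn n × ℂ => p.1 + p.2 • a :=
    (by fun_prop : Continuous fun p : Cn n × ℂ => p.1 + p.2 • a).measurable
  have hm : Measurable fun p : Cn n × ℂ => κ p.2 * F (p.1 + p.2 • a) ^ 2 :=
    (hκ.comp measurable_snd).mul ((hF.comp hadd).pow_const 2)
  calc ∫⁻ z, (∫⁻ ζ, κ ζ * F (z + ζ • a)) ^ 2
      ≤ ∫⁻ z, (∫⁻ ζ, κ ζ) * ∫⁻ ζ, κ ζ * F (z + ζ • a) ^ 2 := by
        refine lintegral_mono fun z => lintegral_mul_sq_le volume hκ ?_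
        exact hF.comp (hadd.comp measurable_prodMk_left)
    _ = (∫⁻ ζ, κ ζ) * ∫⁻ ζ, ∫⁻ z, κ ζ * F (z + ζ • a) ^ 2 := by
        rw [lintegral_const_mul _ hm.lintegral_prod_right', lintegral_lintegral_swap hm.aemeasurable]
    _ = (∫⁻ ζ, κ ζ) * ∫⁻ ζ, κ ζ * ∫⁻ y, F y ^ 2 := by
        congr 1
        refine lintegral_congr fun ζ => ?_
        have hms : Measurable fun z => F (z + ζ • a) ^ 2 :=
          (hF.comp (hadd.comp measurable_prodMk_right)).pow_const 2
        rw [lintegral_const_mul _ hms,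
          lintegral_add_right_eq_self (fun y => F y ^ 2)]
    _ = (∫⁻ ζ, κ ζ) ^ 2 * ∫⁻ y, F y ^ 2 := by
        rw [lintegral_mul_const _ hκ, sq, mul_assoc]

/-- The slice transform is bounded from `L²` of the shell to `L²` of the inner set. -/
theorem exists_lintegral_sliceTransform_sq_le {n : ℕ} {E S : Set (Cn n)} {X : Cn n → ℝ}
    {α β M L L' : ℝ} {a : Cn n} {ℓ : Cn n → ℝ} (hE : IsClosed E) (hSm : MeasurableSet S)
    (hX : IsCutoff E α β M X) (hα : 0 < α) (hS : ∀ y, infDist y E ∈ Icc α β → y ∈ S)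
    (hℓ : ∀ z ∈ E, |ℓ z| ≤ L') :
    ∃ C : ℝ≥0, ∀ (f : Cn n → ℂ) (B : ℝ), IsBoundedOnShell f S a ℓ L B →
      ∫⁻ z in E, ‖sliceTransform f X a z‖ₑ ^ 2 ≤ C * ∫⁻ y in S, ‖f y‖ₑ ^ 2 := by
  -- Here 2M bounds the ∂̄ factor, L + L' is the half-width of the strip seen from a point of E, and
  -- |ζ| ≥ α because the shell has distance at least α from E.
  set K : ℝ := 2 * M * (Real.exp (2 * (L + L') ^ 2) / α) with hK
  set κ : ℂ → ℝ≥0∞ := fun ζ => ENNReal.ofReal (K * Real.exp (-‖ζ‖ ^ 2)) with hκ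
  have hκm : Measurable κ := by
    have : Continuous fun ζ : ℂ => K * Real.exp (-‖ζ‖ ^ 2) := by fun_prop
    exact this.measurable.ennreal_ofReal
  have hκi : ∫⁻ ζ, κ ζ ≠ ∞ := (integrable_gaussian_plane.const_mul K).lintegral_lt_top.ne
  refine ⟨((∫⁻ ζ, κ ζ) ^ 2).toNNReal, fun f B h => ?_⟩
  rw [ENNReal.coe_toNNReal (ENNReal.pow_ne_top hκi)]
  set F : Cn n → ℝ≥0∞ := S.indicator fun y => ‖f y‖ₑ with hF
  have hFm : Measurable F := h.measurable.enorm.indicator hSm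
  have hFS : ∫⁻ y, F y ^ 2 = ∫⁻ y in S, ‖f y‖ₑ ^ 2 := by
    rw [← lintegral_indicator hSm]
    refine lintegral_congr fun y => ?_
    by_cases hy : y ∈ S <;> simp [hF, hy]
  rw [← hFS]
  refine le_trans ?_ (lintegral_sq_lintegral_slice_le hκm hFm a)
  refine (setLIntegral_mono' hE.measurableSet fun z hz => ?_).trans (setLIntegral_le_lintegral E _)
  refine pow_le_pow_left' ((enorm_integral_le_lintegral_enorm _).trans
    (lintegral_mono fun ζ => ?_)) 2
  by_cases hζ : infDist (z + ζ • a) E ∈ Icc α β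
  · have hzS := hS _ hζ
    have hd0 : infDist z E = 0 := infDist_zero_of_mem hz
    have hαζ : α ≤ ‖ζ‖ := by
      have h1 := abs_le.1 (abs_infDist_slice_sub_le E h.norm_dir z ζ)
      linarith [hζ.1, h1.2]
    have h1 := norm_dbar_le (hX.norm_fderiv_slice_le h.norm_dir z ζ)
    have h2 : |ζ.re| ≤ L + L' := (h.abs_re_le hzS).trans (by linarith [hℓ z hz])
    have h3 := norm_cexp_sq_le h2
    have hM0 : 0 ≤ 2 * M := (norm_nonneg _).trans h1
    have h4 : ‖dbar (fun x : ℂ => X (z + x • a)) ζ * (f (z + ζ • a) * cexp (ζ ^ 2) / ζ)‖ ≤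
        K * Real.exp (-‖ζ‖ ^ 2) * ‖f (z + ζ • a)‖ := by
      rw [norm_mul, norm_div, norm_mul]
      calc _ ≤ 2 * M * (‖f (z + ζ • a)‖ *
            (Real.exp (2 * (L + L') ^ 2) * Real.exp (-‖ζ‖ ^ 2)) / α) := by gcongr
        _ = _ := by
          rw [hK]
          ring
    rw [hF, indicator_of_mem hzS, ← ofReal_norm, ← ofReal_norm, hκ, ← ENNReal.ofReal_mul']
    · exact ENNReal.ofReal_le_ofReal h4
    · exact norm_nonneg _
  · rw [hX.dbar_slice_eq_zero hζ, zero_mul, enorm_zero]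
    exact zero_le

end SquareEstimate

/-! ### Choice of the direction and of the linear forms. -/

section Direction

open Metric Set Filter Topology Complex

theorem inner_smul_self_eq {n : ℕ} {a : Cn n} (ha : ‖a‖ = 1) (ζ : ℂ) :
    inner ℝ a (ζ • a) = ζ.re := by
  have h1 : inner ℝ a (ζ • a) = ζ.re * inner ℝ a a := by
    simp only [PiLp.inner_apply, Finset.mul_sum]
    refine Finset.sum_congr rfl fun i _ => ?_
    simp only [Complex.inner, PiLp.smul_apply, smul_eq_mul, mul_re, mul_im, conj_re, conj_im]
    ring
  rw [h1, real_inner_self_eq_norm_sq, ha]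
  norm_num

/-- A complex direction `a` and two real linear forms that vanish on a given subspace of
codimension at least three: the first one is the real part on `ℂ a`, the second one is zero
on `ℂ a`. -/
theorem exists_direction {n : ℕ} (V : Submodule ℝ (Cn n)) (hV : 3 ≤ Module.finrank ℝ (Cn n ⧸ V)) :
    ∃ (a : Cn n) (ℓ m : Cn n →L[ℝ] ℝ), ‖a‖ = 1 ∧ (∀ ζ : ℂ, ℓ (ζ • a) = ζ.re) ∧
      (∀ ζ : ℂ, m (ζ • a) = 0) ∧ m ≠ 0 ∧ ∀ v ∈ V, ℓ v = 0 ∧ m v = 0 := by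
  have hfin : 3 ≤ Module.finrank ℝ Vᗮ := by
    have h1 := V.finrank_quotient_add_finrank
    have h2 := V.finrank_add_finrank_orthogonal
    omega
  have : Nontrivial Vᗮ := Module.nontrivial_of_finrank_pos (R := ℝ) (by omega)
  obtain ⟨a, ha⟩ := exists_norm_eq (Vᗮ : Type _) (zero_le_one (α := ℝ))
  have ha1 : ‖(a : Cn n)‖ = 1 := ha
  -- Orthogonality to a and to I • a is two real conditions on Vᗮ, which has dimension at least
  -- three; so b ≠ 0 exists. This is where the codimension enters.
  let T : Vᗮ →ₗ[ℝ] ℝ × ℝ :=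
    ((innerSL ℝ (a : Cn n)).toLinearMap.prod (innerSL ℝ (I • (a : Cn n))).toLinearMap) ∘ₗ
      Vᗮ.subtype
  obtain ⟨b, hb, hb0⟩ := (Submodule.ne_bot_iff _).1 (LinearMap.ker_ne_bot_of_finrank_lt (f := T)
    (by simp; omega))
  have hTb : T b = 0 := hb
  have hb1 : inner ℝ (a : Cn n) (b : Cn n) = 0 := congrArg Prod.fst hTb
  have hb2 : inner ℝ (I • (a : Cn n)) (b : Cn n) = 0 := congrArg Prod.snd hTb
  refine ⟨a, innerSL ℝ (a : Cn n), innerSL ℝ (b : Cn n), ha1, fun ζ => inner_smul_self_eq ha1 ζ,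
    fun ζ => ?_, fun h0 => hb0 ?_, fun v hv => ⟨?_, ?_⟩⟩
  · have hζ : ζ • (a : Cn n) = ζ.re • (a : Cn n) + ζ.im • (I • (a : Cn n)) := by
      conv_lhs => rw [← re_add_im ζ]
      rw [add_smul, mul_smul, coe_smul, coe_smul]
    rw [innerSL_apply_apply, hζ, inner_add_right, real_inner_smul_right, real_inner_smul_right,
      real_inner_comm, hb1, real_inner_comm, hb2]
    simp
  · have h1 : innerSL ℝ (b : Cn n) (b : Cn n) = 0 := by
      rw [h0]
      simp
    exact Subtype.ext (inner_self_eq_zero.1 h1)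
  · exact (Submodule.mem_orthogonal' V _).1 a.2 v hv
  · exact (Submodule.mem_orthogonal' V _).1 b.2 v hv

/-- The form is constant on H, so on the tube it differs from that constant by at most ‖ℓ‖R. -/
theorem exists_abs_le_of_subset_thickening {n : ℕ} {H : AffineSubspace ℝ (Cn n)}
    (hH : (H : Set (Cn n)).Nonempty) {R : ℝ} {E : Set (Cn n)}
    (hE : E ⊆ thickening R (H : Set (Cn n))) (ℓ : Cn n →L[ℝ] ℝ) (hℓ : ∀ v ∈ H.direction, ℓ v = 0) :
    ∃ L, ∀ y ∈ E, |ℓ y| ≤ L := by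
  obtain ⟨h₀, hh₀⟩ := hH
  refine ⟨‖ℓ‖ * R + |ℓ h₀|, fun y hy => ?_⟩
  obtain ⟨h, hh, hd⟩ := mem_thickening_iff.1 (hE hy)
  have h1 : ℓ h = ℓ h₀ := by
    have := hℓ (h - h₀) (H.vsub_mem_direction hh hh₀)
    rw [map_sub] at this
    linarith
  have h2 : |ℓ (y - h)| ≤ ‖ℓ‖ * R := by
    refine (ℓ.le_opNorm _).trans ?_
    rw [← dist_eq_norm]
    gcongr
  calc |ℓ y| = |ℓ (y - h) + ℓ h₀| := by rw [map_sub, h1]; ring_nf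
    _ ≤ _ := (abs_add_le _ _).trans (by linarith)

theorem exists_abs_le_of_infDist_le {n : ℕ} {E : Set (Cn n)} (hE : E.Nonempty)
    (ℓ : Cn n →L[ℝ] ℝ) {L : ℝ} (hL : ∀ y ∈ E, |ℓ y| ≤ L) (t : ℝ) :
    ∃ L', ∀ y, infDist y E ≤ t → |ℓ y| ≤ L' := by
  refine ⟨‖ℓ‖ * (t + 1) + L, fun y hy => ?_⟩
  obtain ⟨e, he, hd⟩ := (infDist_lt_iff hE).1 (hy.trans_lt (lt_add_one t))
  have h2 : |ℓ (y - e)| ≤ ‖ℓ‖ * (t + 1) := by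
    refine (ℓ.le_opNorm _).trans ?_
    rw [← dist_eq_norm]
    gcongr
  calc |ℓ y| = |ℓ (y - e) + ℓ e| := by rw [map_sub]; ring_nf
    _ ≤ _ := (abs_add_le _ _).trans (add_le_add h2 (hL e he))

end Direction

/-! ### The extension theorem with L² bounds. -/

section Extension

open Metric Set Filter Topology Complex

variable {n : ℕ} {Ω E : Set (Cn n)} {r s : ℝ}

theorem mem_of_infDist_le (hE : E.Nonempty) (hr : cthickening r E ⊆ Ω) {y : Cn n}
    (hy : infDist y E ≤ r) : y ∈ Ω := by
  refine hr ?_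
  rw [mem_cthickening_iff]
  exact (ENNReal.ofReal_toReal (infEDist_ne_top hE)).symm.le.trans (ENNReal.ofReal_le_ofReal hy)

theorem notMem_of_infDist_pos {y : Cn n} (hy : 0 < infDist y E) : y ∉ E := fun h =>
  hy.ne' (infDist_zero_of_mem h)

/-- Square integrable holomorphic functions off `E` are bounded with their derivatives on shells
around `E`. -/
theorem isBoundedOnShell_indicator (hΩ : IsOpen Ω) (hE : IsClosed E) (hEn : E.Nonempty)
    (hs : 0 < s) (hr : cthickening (8 * s) E ⊆ Ω) {a : Cn n} (ha : ‖a‖ = 1) (ℓ : Cn n →L[ℝ] ℝ)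
    (hℓa : ∀ ζ : ℂ, ℓ (ζ • a) = ζ.re) {L : ℝ}
    (hL : ∀ y, infDist y E ∈ Icc (s / 2) (6 * s) → |ℓ y| ≤ L) {f : Cn n → ℂ}
    (hf : f ∈ bergmanSpace (Ω \ E)) :
    ∃ B, IsBoundedOnShell ((Ω \ E).indicator f) {y | infDist y E ∈ Icc (s / 2) (6 * s)} a ℓ L B := by
  have hU : IsOpen (Ω \ E) := hΩ.sdiff hE
  obtain ⟨A, hA⟩ := exists_enorm_le_eLpNorm n (ρ := s / 4) (by positivity)
  have hnorm : eLpNorm f 2 (volume.restrict (Ω \ E)) ≠ ∞ := hf.2.eLpNorm_ne_top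
  set B₀ : ℝ := (A * eLpNorm f 2 (volume.restrict (Ω \ E))).toReal with hB₀
  have hB₀0 : 0 ≤ B₀ := ENNReal.toReal_nonneg
  have hball : ∀ y, infDist y E ∈ Icc (s / 2) (6 * s) → ball y (s / 2) ⊆ Ω \ E := by
    intro y hy x hx
    have h1 := abs_le.1 (abs_infDist_sub_infDist_le E x y)
    have h2 : dist x y < s / 2 := hx
    exact ⟨mem_of_infDist_le hEn hr (by linarith [hy.2, h1.2]),
      notMem_of_infDist_pos (by linarith [hy.1, h1.1])⟩
  have hbd : ∀ y, infDist y E ∈ Icc (s / 2) (6 * s) → ∀ x ∈ ball y (s / 4), ‖f x‖ ≤ B₀ := by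
    intro y hy x hx
    have hsub : ball x (s / 4) ⊆ Ω \ E := by
      refine (ball_subset_ball' ?_).trans (hball y hy)
      have : dist x y < s / 4 := hx
      linarith
    have := hA _ x f hsub hf.1
    rw [hB₀, ← toReal_enorm]
    exact ENNReal.toReal_mono (ENNReal.mul_ne_top ENNReal.coe_ne_top hnorm) this
  have hmemy : ∀ y, infDist y E ∈ Icc (s / 2) (6 * s) → y ∈ Ω \ E := fun y hy =>
    hball y hy (mem_ball_self (by positivity))
  have hev : ∀ y, infDist y E ∈ Icc (s / 2) (6 * s) → (Ω \ E).indicator f =ᶠ[𝓝 y] f := by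
    intro y hy
    filter_upwards [hU.mem_nhds (hmemy y hy)] with x hx
    exact indicator_of_mem hx f
  refine ⟨max B₀ (2 * B₀ / (s / 4)), hB₀0.trans (le_max_left _ _), ?_, fun y hy => ?_,
    fun y hy => ?_, fun y hy => ?_, ha, fun y ζ => by rw [map_add, hℓa], fun y hy => hL y hy⟩
  · exact measurable_indicator_of_continuousOn hU.measurableSet hf.1.continuousOn
  · exact (hf.1.differentiableAt (hU.mem_nhds (hmemy y hy))).congr_of_eventuallyEq (hev y hy)
  · rw [(hev y hy).self_of_nhds]
    exact (hbd y hy y (mem_ball_self (by positivity))).trans (le_max_left _ _)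
  · rw [(hev y hy).fderiv_eq]
    refine (norm_fderiv_le_of_bounded_ball (by positivity : 0 < s / 4)
      (hf.1.mono ((ball_subset_ball (by linarith)).trans (hball y hy))) (hbd y hy)).trans
      (le_max_right _ _)

/-- If a linear form which is constant on the complex lines of direction `a` is bounded near `E`,
then the slice transform vanishes on the unbounded part of the complement of `E`; hence there are
points close to `E` near which it vanishes. -/
theorem exists_eventually_sliceTransform_eq_zero {f : Cn n → ℂ} {X : Cn n → ℝ} {M t : ℝ}
    {a : Cn n} {β α : ℝ} (hX : IsCutoff E α β M X) (hEn : E.Nonempty) (ht0 : 0 ≤ t) (hβt : β ≤ t)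
    (hd : ∀ w, t < infDist w E → DifferentiableAt ℂ (sliceTransform f X a) w)
    (m : Cn n →L[ℝ] ℝ) (hma : ∀ ζ : ℂ, m (ζ • a) = 0) (hm0 : m ≠ 0) {L : ℝ}
    (hL : ∀ y, infDist y E ≤ t → |m y| ≤ L) {t' : ℝ} (htt' : t < t') :
    ∃ q, infDist q E = t' ∧ ∀ᶠ x in 𝓝 q, sliceTransform f X a x = 0 := by
  obtain ⟨v, hv⟩ : ∃ v, m v ≠ 0 := by
    by_contra! hcon
    exact hm0 (ContinuousLinearMap.ext hcon)
  obtain ⟨L', hL'⟩ := exists_abs_le_of_infDist_le hEn m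
    (fun y hy => hL y (by rw [infDist_zero_of_mem hy]; exact ht0)) t'
  -- The scaling makes m p exceed L, so lines near p miss the region around E, and L', so p lies
  -- farther than t' from E.
  set p : Cn n := ((max L L' + 1) / m v) • v with hp
  have hmp : m p = max L L' + 1 := by
    rw [hp, map_smul, smul_eq_mul, div_mul_cancel₀ _ hv]
  have hmp1 : L < |m p| := (lt_of_le_of_lt (le_max_left L L') (by linarith)).trans_le (le_abs_self _)
  have hmp2 : L' < |m p| := (lt_of_le_of_lt (le_max_right L L') (by linarith)).trans_le (le_abs_self _)
  have hpt' : t' < infDist p E := by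
    by_contra! hcon
    exact absurd (hL' p hcon) (not_le.2 hmp2)
  set W : Set (Cn n) := {w | t < infDist w E} with hW
  have hWo : IsOpen W := isOpen_lt continuous_const (continuous_infDist_pt E)
  have hpW : p ∈ W := htt'.trans hpt'
  set U := connectedComponentIn W p with hU
  have hUo : IsOpen U := hWo.connectedComponentIn
  have hUW : U ⊆ W := connectedComponentIn_subset W p
  have hpU : p ∈ U := mem_connectedComponentIn hpW
  have hzero : ∀ x ∈ U, sliceTransform f X a x = 0 := by
    refine eq_zero_of_eventuallyEq_zero hUo isPreconnected_connectedComponentIn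
      (fun w hw => (hd w (hUW hw)).differentiableWithinAt) hpU ?_
    have hcont : Continuous fun x => |m x| := by fun_prop
    filter_upwards [hcont.continuousAt.eventually (lt_mem_nhds hmp1)] with x hx
    refine sliceTransform_eq_zero hX fun ζ => hβt.trans_lt ?_
    by_contra! hcon
    have := hL _ hcon
    rw [map_add, hma, add_zero] at this
    exact absurd this (not_le.2 hx)
  obtain ⟨e, he⟩ := hEn
  -- Along the segment from p to a point of E, up to the first time at distance t', the distance
  -- exceeds t; this part stays in the component of p.
  set γ : ℝ → Cn n := fun τ => p + τ • (e - p) with hγ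
  have hγc : Continuous γ := by fun_prop
  have hdc : Continuous fun τ => infDist (γ τ) E := (continuous_infDist_pt E).comp hγc
  have hd0 : infDist (γ 0) E = infDist p E := by simp [hγ]
  have hd1 : infDist (γ 1) E = 0 := by simp [hγ, infDist_zero_of_mem he]
  -- the first parameter at which the distance is `t'`
  set Z : Set ℝ := Icc 0 1 ∩ {τ | infDist (γ τ) E ≤ t'} with hZ
  have hZc : IsCompact Z := isCompact_Icc.inter_right (isClosed_le hdc continuous_const)
  have hZn : Z.Nonempty := ⟨1, ⟨zero_le_one, le_rfl⟩, by
    change infDist (γ 1) E ≤ t'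
    rw [hd1]
    linarith⟩
  obtain ⟨τ₀, hτ₀, hmin⟩ := hZc.exists_isLeast hZn
  have hbefore : ∀ τ ∈ Ico 0 τ₀, t' < infDist (γ τ) E := by
    intro τ hτ
    by_contra! hcon
    exact absurd (hmin ⟨⟨hτ.1, hτ.2.le.trans hτ₀.1.2⟩, hcon⟩) (not_le.2 hτ.2)
  have hτ₀le : infDist (γ τ₀) E ≤ t' := hτ₀.2
  have hτ₀pos : 0 < τ₀ := by
    refine lt_of_le_of_ne hτ₀.1.1 fun h0 => ?_
    rw [← h0, hd0] at hτ₀le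
    linarith
  have hτ₀ge : t' ≤ infDist (γ τ₀) E := by
    have hcl : τ₀ ∈ closure (Ico 0 τ₀) := by
      rw [closure_Ico hτ₀pos.ne]
      exact ⟨hτ₀pos.le, le_rfl⟩
    exact closure_minimal (fun τ hτ => (hbefore τ hτ).le) (isClosed_le continuous_const hdc) hcl
  have hpath : γ '' Icc 0 τ₀ ⊆ U := by
    refine (isPreconnected_Icc.image γ hγc.continuousOn).subset_connectedComponentIn
      ⟨0, ⟨le_rfl, hτ₀pos.le⟩, by simp [hγ]⟩ ?_
    rintro _ ⟨τ, hτ, rfl⟩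
    rcases hτ.2.lt_or_eq with h | h
    · exact htt'.trans (hbefore τ ⟨hτ.1, h⟩)
    · rw [h]
      exact htt'.trans_le hτ₀ge
  have hq : γ τ₀ ∈ U := hpath ⟨τ₀, ⟨hτ₀pos.le, le_rfl⟩, rfl⟩
  exact ⟨γ τ₀, le_antisymm hτ₀le hτ₀ge,
    (hUo.mem_nhds hq |> fun h => Filter.mem_of_superset h hzero)⟩

/-- Hartogs-type extension with `L²` bounds across a closed set contained in a tube around a real
affine subspace of codimension at least three. -/
theorem exists_bergman_extension (hΩ : IsOpen Ω) (hE : IsClosed E)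
    (hEn : E.Nonempty) (hr0 : 0 < r) (hr : cthickening r E ⊆ Ω) {H : AffineSubspace ℝ (Cn n)}
    (hHn : (H : Set (Cn n)).Nonempty) (hH : 3 ≤ Module.finrank ℝ (Cn n ⧸ H.direction)) {R : ℝ}
    (hER : E ⊆ thickening R (H : Set (Cn n))) (hc : IsConnected (Ω \ E)) :
    ∃ C : ℝ≥0, ∀ f ∈ bergmanSpace (Ω \ E), ∃ F : Cn n → ℂ, DifferentiableOn ℂ F Ω ∧
      EqOn F f (Ω \ E) ∧
      ∫⁻ z in Ω, ‖F z‖ₑ ^ 2 ≤ C * ∫⁻ z in Ω \ E, ‖f z‖ₑ ^ 2 := by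
  obtain ⟨a, ℓ, m, ha, hℓa, hma, hm0, hv⟩ := exists_direction H.direction hH
  obtain ⟨Lℓ, hLℓ⟩ := exists_abs_le_of_subset_thickening hHn hER ℓ fun v hvH => (hv v hvH).1
  obtain ⟨Lm, hLm⟩ := exists_abs_le_of_subset_thickening hHn hER m fun v hvH => (hv v hvH).2
  -- The collar is cut so that the gradient of Y lives at distances s to 2s, that of X at 4s to 5s,
  -- and the two definitions of F overlap between 5s/2 and 3s.
  set s : ℝ := r / 8 with hs
  have hs0 : 0 < s := by positivity
  have hr8 : cthickening (8 * s) E ⊆ Ω := by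
    convert hr using 2
    rw [hs]
    ring
  obtain ⟨L, hL⟩ := exists_abs_le_of_infDist_le hEn ℓ hLℓ (6 * s)
  obtain ⟨L₂, hL₂⟩ := exists_abs_le_of_infDist_le hEn m hLm (5 / 2 * s)
  obtain ⟨M, X, hX⟩ := exists_isCutoff E (α := 4 * s) (β := 5 * s) (by linarith)
  obtain ⟨M', Y, hY⟩ := exists_isCutoff E (α := s) (β := 2 * s) (by linarith)
  set S : Set (Cn n) := {y | infDist y E ∈ Icc (s / 2) (6 * s)} with hS
  have hSc : IsClosed S := isClosed_Icc.preimage (continuous_infDist_pt E)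
  obtain ⟨C, hC⟩ := exists_lintegral_sliceTransform_sq_le (L := L) (a := a) (S := S) hE
    hSc.measurableSet hX (by linarith) (fun y hy => ⟨by linarith [hy.1], by linarith [hy.2]⟩) hLℓ
  -- The 1 accounts for Ω \ E, where F = f, and C for E.
  refine ⟨1 + C, fun f hf => ?_⟩
  have hU : IsOpen (Ω \ E) := hΩ.sdiff hE
  obtain ⟨B, hB⟩ := isBoundedOnShell_indicator hΩ hE hEn hs0 hr8 ha ℓ hℓa
    (fun y hy => hL y hy.2) hf
  set f₀ := (Ω \ E).indicator f with hf₀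
  have hπ : (2 * Real.pi : ℂ) ≠ 0 := by
    have : (Real.pi : ℂ) ≠ 0 := by exact_mod_cast Real.pi_ne_zero
    simp [this]
  have hdX : ∀ w, infDist w E < 3 * s → DifferentiableAt ℂ (sliceTransform f₀ X a) w :=
    fun w hw => differentiableAt_sliceTransform hB hX (δ := s / 8) (by positivity)
      (fun y hy => ⟨by linarith [hy.1], by linarith [hy.2]⟩) (Or.inl (by linarith))
  have hdY : ∀ w, 5 / 2 * s < infDist w E → DifferentiableAt ℂ (sliceTransform f₀ Y a) w :=
    fun w hw => differentiableAt_sliceTransform hB hY (δ := s / 8) (by positivity)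
      (fun y hy => ⟨by linarith [hy.1], by linarith [hy.2]⟩) (Or.inr (by linarith))
  have hjump : ∀ z, 5 / 2 * s < infDist z E → infDist z E < 3 * s →
      -(2 * Real.pi : ℂ)⁻¹ * sliceTransform f₀ X a z =
        f₀ z - (2 * Real.pi : ℂ)⁻¹ * sliceTransform f₀ Y a z := by
    intro z hz1 hz2
    have := sliceTransform_sub_sliceTransform hB hX hY
      (fun y hy => ⟨by linarith [hy.1], by linarith [hy.2]⟩) (z := z) (by linarith) (by linarith)
      (by linarith) (by linarith)
    rw [sub_eq_iff_eq_add] at this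
    rw [this]
    field_simp
    ring
  classical
  set F : Cn n → ℂ := fun z => if infDist z E < 3 * s then
    -(2 * Real.pi : ℂ)⁻¹ * sliceTransform f₀ X a z else
    f₀ z - (2 * Real.pi : ℂ)⁻¹ * sliceTransform f₀ Y a z with hF
  have hcd : Continuous fun z => infDist z E := continuous_infDist_pt E
  have hF1 : ∀ z, infDist z E < 3 * s → F z = -(2 * Real.pi : ℂ)⁻¹ * sliceTransform f₀ X a z :=
    fun z hz => by simp [hF, hz]
  have hF2 : ∀ z, 5 / 2 * s < infDist z E →
      F z = f₀ z - (2 * Real.pi : ℂ)⁻¹ * sliceTransform f₀ Y a z := fun z hz => by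
    by_cases h3 : infDist z E < 3 * s
    · rw [hF1 z h3, hjump z hz h3]
    · simp [hF, h3]
  have hFd : DifferentiableOn ℂ F Ω := by
    intro z hz
    refine DifferentiableAt.differentiableWithinAt ?_
    by_cases h3 : infDist z E < 3 * s
    · refine ((hdX z h3).const_mul (-(2 * Real.pi : ℂ)⁻¹)).congr_of_eventuallyEq ?_
      filter_upwards [hcd.continuousAt.eventually (gt_mem_nhds h3)] with x hx using hF1 x hx
    · have h3' : 5 / 2 * s < infDist z E := by linarith
      have hzU : z ∈ Ω \ E := ⟨hz, notMem_of_infDist_pos (by linarith)⟩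
      have hf₀d : DifferentiableAt ℂ f₀ z := by
        refine (hf.1.differentiableAt (hU.mem_nhds hzU)).congr_of_eventuallyEq ?_
        filter_upwards [hU.mem_nhds hzU] with x hx using indicator_of_mem hx f
      refine (hf₀d.sub ((hdY z h3').const_mul ((2 * Real.pi : ℂ)⁻¹))).congr_of_eventuallyEq ?_
      filter_upwards [hcd.continuousAt.eventually (lt_mem_nhds h3')] with x hx using hF2 x hx
  have hFf : EqOn F f (Ω \ E) := by
    obtain ⟨q, hqd, hq⟩ := exists_eventually_sliceTransform_eq_zero hY hEn
      (t := 5 / 2 * s) (by positivity) (by linarith) hdY m hma hm0 hL₂ (t' := 11 / 4 * s) (by linarith)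
    have hqU : q ∈ Ω \ E := ⟨mem_of_infDist_le hEn hr8 (by linarith),
      notMem_of_infDist_pos (by linarith)⟩
    refine eqOn_of_eventuallyEq_of_isPreconnected hU hc.isPreconnected
      (hFd.mono sdiff_subset) hf.1 hqU ?_
    have hqd' : 5 / 2 * s < infDist q E := by linarith
    filter_upwards [hq, hU.mem_nhds hqU, hcd.continuousAt.eventually (lt_mem_nhds hqd')]
      with x hx1 hx2 hx3
    rw [hF2 x hx3, hx1, mul_zero, sub_zero, hf₀, indicator_of_mem hx2]
  refine ⟨F, hFd, hFf, ?_⟩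
  have hEΩ : E ⊆ Ω := fun y hy => mem_of_infDist_le hEn hr8 (by
    rw [infDist_zero_of_mem hy]
    positivity)
  have hsplit : ∫⁻ z in Ω, ‖F z‖ₑ ^ 2 =
      (∫⁻ z in Ω \ E, ‖F z‖ₑ ^ 2) + ∫⁻ z in E, ‖F z‖ₑ ^ 2 := by
    rw [← lintegral_union hE.measurableSet disjoint_sdiff_left, sdiff_union_of_subset hEΩ]
  have hout : ∫⁻ z in Ω \ E, ‖F z‖ₑ ^ 2 = ∫⁻ z in Ω \ E, ‖f z‖ₑ ^ 2 :=
    setLIntegral_congr_fun hU.measurableSet fun z hz => by rw [hFf hz]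
  have hSΩ : S ⊆ Ω \ E := fun y hy => ⟨mem_of_infDist_le hEn hr8 (by linarith [hy.2]),
    notMem_of_infDist_pos (by linarith [hy.1])⟩
  have hin : ∫⁻ z in E, ‖F z‖ₑ ^ 2 ≤ C * ∫⁻ z in Ω \ E, ‖f z‖ₑ ^ 2 := by
    calc ∫⁻ z in E, ‖F z‖ₑ ^ 2 ≤ ∫⁻ z in E, ‖sliceTransform f₀ X a z‖ₑ ^ 2 := by
          refine setLIntegral_mono' hE.measurableSet fun z hz => ?_
          refine pow_le_pow_left' ?_ 2
          rw [hF1 z (by rw [infDist_zero_of_mem hz]; positivity), enorm_mul]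
          refine mul_le_of_le_one_left zero_le ?_
          rw [← ofReal_norm, ENNReal.ofReal_le_one, norm_neg, norm_inv]
          refine inv_le_one_of_one_le₀ ?_
          rw [norm_mul, Complex.norm_two, norm_real, Real.norm_of_nonneg Real.pi_pos.le]
          linarith [Real.pi_gt_three]
      _ ≤ C * ∫⁻ y in S, ‖f₀ y‖ₑ ^ 2 := hC f₀ B hB
      _ = C * ∫⁻ y in S, ‖f y‖ₑ ^ 2 := by
          congr 1
          exact setLIntegral_congr_fun hSc.measurableSet fun z hz => by
            rw [hf₀, indicator_of_mem (hSΩ hz)]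
      _ ≤ _ := by gcongr
  rw [hsplit, hout, ENNReal.coe_add, ENNReal.coe_one, add_mul, one_mul]
  gcongr

end Extension

/-! ### Comparison of the kernels. -/

section Comparison

open Metric Set Filter Topology

/-- The Cauchy–Schwarz inequality. -/
theorem enorm_integral_mul_conj_sq_le {α : Type*} [MeasurableSpace α] {μ : Measure α} {f g : α → ℂ}
    (hf : AEStronglyMeasurable f μ) (hg : AEStronglyMeasurable g μ) :
    ‖∫ x, f x * conj (g x) ∂μ‖ₑ ^ 2 ≤ eLpNorm f 2 μ ^ 2 * eLpNorm g 2 μ ^ 2 := by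
  have h1 : ‖∫ x, f x * conj (g x) ∂μ‖ₑ ≤ ∫⁻ x, ‖f x‖ₑ * ‖g x‖ₑ ∂μ := by
    refine (enorm_integral_le_lintegral_enorm _).trans_eq (lintegral_congr fun x => ?_)
    rw [enorm_mul]
    congr 1
    simp [← ofReal_norm]
  have h2 := ENNReal.lintegral_mul_le_Lp_mul_Lq μ Real.HolderConjugate.two_two hf.enorm hg.enorm
  have h3 := pow_le_pow_left' (h1.trans h2) 2
  rw [mul_pow, ← ENNReal.rpow_natCast (_ ^ (1 / 2 : ℝ)), ← ENNReal.rpow_natCast (_ ^ (1 / 2 : ℝ)),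
    ← ENNReal.rpow_mul, ← ENNReal.rpow_mul] at h3
  norm_num at h3
  rwa [eLpNorm_two_sq_eq_lintegral, eLpNorm_two_sq_eq_lintegral]

theorem bergmanSpace_mono {n : ℕ} {U V : Set (Cn n)} (h : U ⊆ V) {f : Cn n → ℂ}
    (hf : f ∈ bergmanSpace V) : f ∈ bergmanSpace U :=
  ⟨hf.1.mono h, hf.2.mono_measure (Measure.restrict_mono_set _ h)⟩

variable {n : ℕ} {Ω E E₀ : Set (Cn n)}

/-- The `L²` extension from `Ω \ E₀` also extends from the larger set `Ω \ E`. -/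
theorem exists_bergmanSpace_extension (hΩ : IsOpen Ω) (hE : IsClosed E) (hEE : E ⊆ E₀)
    (hE₀ : IsClosed E₀) (hc : IsConnected (Ω \ E)) (hc₀ : IsConnected (Ω \ E₀)) {C : ℝ≥0}
    (hC : ∀ f ∈ bergmanSpace (Ω \ E₀), ∃ F : Cn n → ℂ, DifferentiableOn ℂ F Ω ∧
      EqOn F f (Ω \ E₀) ∧ ∫⁻ z in Ω, ‖F z‖ₑ ^ 2 ≤ C * ∫⁻ z in Ω \ E₀, ‖f z‖ₑ ^ 2)
    {f : Cn n → ℂ} (hf : f ∈ bergmanSpace (Ω \ E)) :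
    ∃ F ∈ bergmanSpace Ω, EqOn F f (Ω \ E) ∧ eLpNorm F 2 (volume.restrict Ω) ^ 2 ≤
      C * eLpNorm f 2 (volume.restrict (Ω \ E)) ^ 2 := by
  have hsub : Ω \ E₀ ⊆ Ω \ E := sdiff_subset_sdiff_right hEE
  obtain ⟨F, hFd, hFf, hFi⟩ := hC f (bergmanSpace_mono hsub hf)
  have hle : eLpNorm F 2 (volume.restrict Ω) ^ 2 ≤
      C * eLpNorm f 2 (volume.restrict (Ω \ E)) ^ 2 := by
    rw [eLpNorm_two_sq_eq_lintegral, eLpNorm_two_sq_eq_lintegral]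
    exact hFi.trans (by gcongr)
  refine ⟨F, ⟨hFd, hFd.continuousOn.aestronglyMeasurable hΩ.measurableSet, ?_⟩, ?_, hle⟩
  · have h1 : eLpNorm F 2 (volume.restrict Ω) ^ 2 < ∞ := hle.trans_lt
      (ENNReal.mul_lt_top ENNReal.coe_lt_top (ENNReal.pow_lt_top hf.2.eLpNorm_lt_top))
    rw [lt_top_iff_ne_top] at h1 ⊢
    exact fun h => h1 (by simp [h])
  · obtain ⟨q, hq⟩ := hc₀.nonempty
    refine eqOn_of_eventuallyEq_of_isPreconnected (hΩ.sdiff hE) hc.isPreconnected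
      (hFd.mono sdiff_subset) hf.1 (hsub hq) ?_
    filter_upwards [(hΩ.sdiff hE₀).mem_nhds hq] with x hx using hFf hx

/-- The comparison of Bergman kernels, from a bounded extension operator and a bound for point
evaluations on `E`. -/
theorem enorm_bergmanKernel_sub_le (hΩ : IsOpen Ω) (hE : IsClosed E) (hEΩ : E ⊆ Ω) {C A : ℝ≥0}
    (hext : ∀ f ∈ bergmanSpace (Ω \ E), ∃ F ∈ bergmanSpace Ω, EqOn F f (Ω \ E) ∧
      eLpNorm F 2 (volume.restrict Ω) ^ 2 ≤ C * eLpNorm f 2 (volume.restrict (Ω \ E)) ^ 2)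
    (hA : ∀ f ∈ bergmanSpace Ω, ∀ e ∈ E, ‖f e‖ₑ ≤ A * eLpNorm f 2 (volume.restrict Ω))
    {z w : Cn n} (hz : z ∈ Ω \ E) (hw : w ∈ Ω \ E) :
    ‖bergmanKernel (Ω \ E) z w - bergmanKernel Ω z w‖ₑ ≤
      ((A ^ 2 * C : ℝ≥0) : ℝ≥0∞) * volume E *
        ENNReal.ofReal (bergmanDiag Ω z + bergmanDiag Ω w) := by
  have hD : IsOpen (Ω \ E) := hΩ.sdiff hE
  have hkD := isReproducingAt_bergmanKernel hD hw
  have hkz := isReproducingAt_bergmanKernel hΩ hz.1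
  have hkw := isReproducingAt_bergmanKernel hΩ hw.1
  obtain ⟨G, hG, hGeq, hGle⟩ := hext _ hkD.1
  set NG := eLpNorm G 2 (volume.restrict Ω) with hNG
  set Nz := eLpNorm (fun ζ => bergmanKernel Ω ζ z) 2 (volume.restrict Ω) with hNz
  have hNz2 : Nz ^ 2 = ENNReal.ofReal (bergmanDiag Ω z) := eLpNorm_bergmanKernel_sq hΩ hz.1
  rw [eLpNorm_bergmanKernel_sq hD hw] at hGle
  -- the kernel on the diagonal grows by a bounded factor only
  have hdiag : ENNReal.ofReal (bergmanDiag (Ω \ E) w) ≤ C * ENNReal.ofReal (bergmanDiag Ω w) := by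
    set t := ENNReal.ofReal (bergmanDiag (Ω \ E) w) with ht
    have h1 : t ≤ ‖G w‖ₑ := by
      rw [hGeq hw, ← ofReal_norm]
      exact ENNReal.ofReal_le_ofReal (Complex.re_le_norm _)
    have h2 : ‖G w‖ₑ ^ 2 ≤ NG ^ 2 * ENNReal.ofReal (bergmanDiag Ω w) := by
      rw [hkw.2 G hG, ← eLpNorm_bergmanKernel_sq hΩ hw.1]
      exact enorm_integral_mul_conj_sq_le hG.2.1 hkw.1.2.1
    -- Here G(w) = K_D(w) with D = Ω \ E, while ‖G‖² ≤ C t; one finite factor t cancels unless it is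
    -- zero.
    have h3 : t * t ≤ t * (C * ENNReal.ofReal (bergmanDiag Ω w)) := by
      calc t * t = t ^ 2 := (sq t).symm
        _ ≤ NG ^ 2 * ENNReal.ofReal (bergmanDiag Ω w) := (pow_le_pow_left' h1 2).trans h2
        _ ≤ C * t * ENNReal.ofReal (bergmanDiag Ω w) := by gcongr
        _ = _ := by ring
    rcases eq_or_ne t 0 with h0 | h0
    · rw [h0]
      exact zero_le
    · exact (ENNReal.mul_le_mul_iff_right h0 ENNReal.ofReal_ne_top).1 h3
  -- The squares give C² K_Ω(w) K_Ω(z), and each diagonal value is at most their sum.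
  have hprod : NG * Nz ≤ C * ENNReal.ofReal (bergmanDiag Ω z + bergmanDiag Ω w) := by
    have h1 : (NG * Nz) ^ 2 ≤ (C * ENNReal.ofReal (bergmanDiag Ω z + bergmanDiag Ω w)) ^ 2 := by
      have hz0 := bergmanDiag_nonneg hΩ hz.1
      have hw0 := bergmanDiag_nonneg hΩ hw.1
      rw [mul_pow, mul_pow, hNz2]
      calc NG ^ 2 * ENNReal.ofReal (bergmanDiag Ω z)
          ≤ C * (C * ENNReal.ofReal (bergmanDiag Ω w)) * ENNReal.ofReal (bergmanDiag Ω z) := by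
            gcongr
            exact hGle.trans (by gcongr)
        _ = C ^ 2 * (ENNReal.ofReal (bergmanDiag Ω w) * ENNReal.ofReal (bergmanDiag Ω z)) := by
            ring
        _ ≤ C ^ 2 * (ENNReal.ofReal (bergmanDiag Ω z + bergmanDiag Ω w)) ^ 2 := by
            rw [sq (ENNReal.ofReal _)]
            gcongr <;> linarith
    exact (ENNReal.pow_le_pow_left_iff two_ne_zero).1 h1
  -- The same integrand over Ω gives G(z) = K_D(z,w), and over D it gives K_Ω(z,w), by reproducing
  -- K_Ω(·,z) at w and conjugating. The difference is the part over E.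
  have hident : bergmanKernel (Ω \ E) z w - bergmanKernel Ω z w =
      ∫ ζ in E, G ζ * conj (bergmanKernel Ω ζ z) := by
    have hkzD : (fun ζ => bergmanKernel Ω ζ z) ∈ bergmanSpace (Ω \ E) :=
      bergmanSpace_mono sdiff_subset hkz.1
    have h1 : bergmanKernel (Ω \ E) z w = ∫ ζ in Ω, G ζ * conj (bergmanKernel Ω ζ z) := by
      rw [← hkz.2 G hG]
      exact (hGeq hz).symm
    have h2 : bergmanKernel Ω z w = ∫ ζ in Ω \ E, G ζ * conj (bergmanKernel Ω ζ z) := by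
      rw [← bergmanKernel_conj_symm hΩ hw.1 hz.1, hkD.2 _ hkzD, ← integral_conj]
      refine setIntegral_congr_fun hD.measurableSet fun ζ hζ => ?_
      simp only [map_mul, Complex.conj_conj]
      rw [hGeq hζ, mul_comm]
    have hint : IntegrableOn (fun ζ => G ζ * conj (bergmanKernel Ω ζ z)) Ω :=
      hG.2.integrable_mul hkz.1.2.star
    rw [h1, h2, sub_eq_iff_eq_add, add_comm]
    have hun := setIntegral_union disjoint_sdiff_left hE.measurableSet
      (hint.mono_set (sdiff_subset (t := E))) (hint.mono_set hEΩ)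
    rwa [sdiff_union_of_subset hEΩ] at hun
  rw [hident]
  calc ‖∫ ζ in E, G ζ * conj (bergmanKernel Ω ζ z)‖ₑ
      ≤ ∫⁻ ζ in E, ‖G ζ * conj (bergmanKernel Ω ζ z)‖ₑ := enorm_integral_le_lintegral_enorm _
    _ ≤ ∫⁻ _ in E, (A * NG) * (A * Nz) := by
        refine setLIntegral_mono' hE.measurableSet fun ζ hζ => ?_
        have h1 : ‖conj (bergmanKernel Ω ζ z)‖ₑ = ‖bergmanKernel Ω ζ z‖ₑ := by
          simp [← ofReal_norm]
        rw [enorm_mul, h1]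
        exact mul_le_mul' (hA G hG ζ hζ) (hA _ hkz.1 ζ hζ)
    _ = A ^ 2 * volume E * (NG * Nz) := by
        rw [setLIntegral_const]
        ring
    _ ≤ A ^ 2 * volume E * (C * ENNReal.ofReal (bergmanDiag Ω z + bergmanDiag Ω w)) := by gcongr
    _ = _ := by
        push_cast
        ring

end Comparison

theorem proposition1p5 {n : ℕ} (hn : 2 ≤ n)
    (Ω : Set (Cn n)) (hΩ_open : IsOpen Ω) (hΩ_conn : IsConnected Ω)
    (E₀ : Set (Cn n)) (hE₀ : IsClosed E₀)
    (h1 : ∃ r : ℝ, 0 < r ∧ Metric.cthickening r E₀ ⊆ Ω)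
    (h2 : ∃ H : AffineSubspace ℝ (Cn n), (H : Set (Cn n)).Nonempty ∧
      3 ≤ Module.finrank ℝ (Cn n ⧸ H.direction) ∧
      ∃ R : ℝ, 0 < R ∧ E₀ ⊆ Metric.thickening R (H : Set (Cn n)))
    (h3 : IsConnected (Ω \ E₀)) :
    (∃ C : ℝ≥0, ∀ E : Set (Cn n), IsClosed E → E ⊆ E₀ → IsConnected (Ω \ E) →
      ∀ z ∈ Ω \ E, ∀ w ∈ Ω \ E,
        ‖bergmanKernel (Ω \ E) z w - bergmanKernel Ω z w‖ₑ ≤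
          (C : ℝ≥0∞) * volume E * ENNReal.ofReal (bergmanDiag Ω z + bergmanDiag Ω w)) ∧
    (∀ E : Set (Cn n), IsClosed E → E ⊆ E₀ → IsConnected (Ω \ E) → volume E = 0 →
      ∀ z ∈ Ω \ E, ∀ w ∈ Ω \ E,
        bergmanKernel (Ω \ E) z w = bergmanKernel Ω z w) := by
  rw [and_iff_left_of_imp]
  · obtain ⟨r, hr0, hr⟩ := h1
    obtain ⟨H, hHn, hH, R, -, hER⟩ := h2
    -- The empty case is separate because `infDist` to the empty set is 0 by convention.
    rcases E₀.eq_empty_or_nonempty with rfl | hEn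
    · refine ⟨0, fun E _ hE _ z _ w _ => ?_⟩
      rw [Set.subset_empty_iff.1 hE]
      simp
    obtain ⟨C, hC⟩ := exists_bergman_extension hΩ_open hE₀ hEn hr0 hr hHn hH hER h3
    obtain ⟨A, hA⟩ := exists_enorm_le_eLpNorm n hr0
    refine ⟨A ^ 2 * C, fun E hE hEE hc z hz w hw => ?_⟩
    have hball : ∀ e ∈ E, Metric.ball e r ⊆ Ω := fun e he x hx =>
      hr (Metric.mem_cthickening_of_dist_le x e r E₀ (hEE he) (Metric.mem_ball.1 hx).le)
    exact enorm_bergmanKernel_sub_le hΩ_open hE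
      (fun e he => hball e he (Metric.mem_ball_self hr0))
      (fun f hf => exists_bergmanSpace_extension hΩ_open hE hEE hE₀ hc h3 hC hf)
      (fun f hf e he => hA Ω e f (hball e he) hf.1) hz hw
  · rintro ⟨C, hC⟩ E hE hEE hc hvol z hz w hw
    have := hC E hE hEE hc z hz w hw
    rw [hvol, mul_zero, zero_mul] at this
    exact sub_eq_zero.1 (enorm_eq_zero.1 (le_antisymm this zero_le))
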